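/- Let $r=\infty$ or $r=\omega$ (real analytic). Let $G$ be a connected Lie group and $M$ a $C^r$ manifold with boundary of dimension $n\ge 1$, with interior $\mathrm{Int}(M)$ and boundary $\partial M$. Let $\rho_0$ be a $C^r$ action of $G$ on $M$ (that is, $(g,x)\mapsto\rho_0(g)x$ is a $C^r$ map $G\times M\to M$) that is transitive on $\mathrm{Int}(M)$. A stretching function is a map $f:[0,1]\to[0,1]$ such that (1) $f$ is an orientation-preserving homeomorphism; (2) $f$ is $C^r$ and its restriction to $]0,1]$ is a $C^r$ diffeomorphism onto $]0,1]$; (3) $f/f'$, defined on $]0,1]$, extends to a $C^r$ function on $[0,1]$. A stretching map associated to $f$ is a homeomorphism $\Phi_f:M\to M$ that is of class $C^r$, restricts to a $C^r$ diffeomorphism $\mathrm{Int}(M)\to\mathrm{Int}(M)$, and is such that for every $p\in\partial M$ there are two $C^r$ coordinate systems $(x_1,\dots,x_{n-1},y)$, around $p$ and around $\Phi_f(p)$, in each of which $y\ge 0$ is a local defining function of $\partial M$, and in which, near $p$, \[\Phi_f(x_1,\dots,x_{n-1},y)=(x_1,\dots,x_{n-1},f(y)).\] A stretch of $\rho_0$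 is an action $\rho_f=\Phi_f^*(\rho_0)$, $\rho_f(g)=\Phi_f^{-1}\circ\rho_0(g)\circ\Phi_f$, where $\Phi_f$ is a stretching map associated to some stretching function $f$. **Theorem.** Any stretch of $\rho_0$ is a $C^r$ action of $G$ on $M$. -/

import Mathlib

open Set Filter Topology
open scoped Manifold ContDiff

/-- A stretching function of class `C^r`: (the restriction to `[0,1]` of) a function `f` such that
* `f` is an orientation-preserving homeomorphism of `[0,1]` onto itself;
* `f` is `C^r` on `[0,1]`, and it restricts to a `C^r` diffeomorphism of `]0,1]` onto itself;
* `f / f'`, defined on `]0,1]`, extends to a `C^r` function on `[0,1]`.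
Only the values of `f` on `[0,1]` matter. -/
structure IsStretchingFunction (r : WithTop ℕ∞) (f : ℝ → ℝ) : Prop where
  bijOn : BijOn f (Icc 0 1) (Icc 0 1)
  strictMonoOn : StrictMonoOn f (Icc 0 1)
  continuousOn : ContinuousOn f (Icc 0 1)
  contDiffOn : ContDiffOn ℝ r f (Icc 0 1)
  exists_inverse : ∃ g : ℝ → ℝ, MapsTo f (Ioc 0 1) (Ioc 0 1) ∧ MapsTo g (Ioc 0 1) (Ioc 0 1) ∧
    InvOn g f (Ioc 0 1) (Ioc 0 1) ∧ ContDiffOn ℝ r g (Ioc 0 1)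
  exists_extension : ∃ h : ℝ → ℝ, ContDiffOn ℝ r h (Icc 0 1) ∧
    ∀ y ∈ Ioc (0 : ℝ) 1, h y = f y / derivWithin f (Icc 0 1) y

section Stretch

variable {n : ℕ} [NeZero n] {M : Type*} [TopologicalSpace M] [ChartedSpace (EuclideanHalfSpace n) M]

/-- `Φ` is a stretching map of class `C^r` associated to `f`, on the `n`-dimensional manifold with
boundary `M`.  Charts of the maximal atlas take values in the half-space `{v | 0 ≤ v 0}`, so their
coordinate of index `0` is the function `y` defining `∂M` locally, and the others are
`x_1, …, x_{n-1}`. -/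
structure IsStretchingMap (r : WithTop ℕ∞) (f : ℝ → ℝ) (Φ : M ≃ₜ M) : Prop where
  contMDiff : ContMDiff (𝓡∂ n) (𝓡∂ n) r Φ
  bijOn_interior : BijOn Φ ((𝓡∂ n).interior M) ((𝓡∂ n).interior M)
  contMDiffOn_symm : ContMDiffOn (𝓡∂ n) (𝓡∂ n) r Φ.symm ((𝓡∂ n).interior M)
  exists_charts : ∀ p ∈ (𝓡∂ n).boundary M,
    ∃ φ ∈ IsManifold.maximalAtlas (𝓡∂ n) r M, ∃ ψ ∈ IsManifold.maximalAtlas (𝓡∂ n) r M,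
      p ∈ φ.source ∧ Φ p ∈ ψ.source ∧
      ∀ᶠ q in 𝓝 p, (ψ (Φ q)).1 0 = f ((φ q).1 0) ∧ ∀ i, i ≠ 0 → (ψ (Φ q)).1 i = (φ q).1 i

variable {E : Type*} [NormedAddCommGroup E] [NormedSpace ℝ E]
  {G : Type*} [TopologicalSpace G] [ChartedSpace E G] [Group G]

/-- `ρ` is a `C^r` action of `G` on `M`: a group action such that `(g, x) ↦ ρ g x` is a `C^r` map
on `G × M`. -/
structure IsDiffAction (r : WithTop ℕ∞) (ρ : G → M → M) : Prop where
  one_act : ∀ x, ρ 1 x = x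
  mul_act : ∀ g h x, ρ (g * h) x = ρ g (ρ h x)
  contMDiff : ContMDiff (𝓘(ℝ, E).prod (𝓡∂ n)) (𝓡∂ n) r (fun q : G × M => ρ q.1 q.2)

/-- The pulled back action `Φ^* ρ`, given by `g ↦ Φ⁻¹ ∘ ρ g ∘ Φ`. -/
def pullbackAction (Φ : M ≃ₜ M) (ρ : G → M → M) : G → M → M :=
  fun g x => Φ.symm (ρ g (Φ x))

/-- `ρ` is a stretch of `ρ₀` (in class `C^r`). -/
def IsStretch (r : WithTop ℕ∞) (ρ₀ ρ : G → M → M) : Prop :=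
  ∃ (f : ℝ → ℝ) (Φ : M ≃ₜ M), IsStretchingFunction r f ∧ IsStretchingMap (n := n) r f Φ ∧
    ρ = pullbackAction Φ ρ₀

end Stretch

/-! At interior points of `M` the pulled back action is a composition of `C^r` maps, since
diffeomorphisms preserve the interior and `Φ⁻¹` is `C^r` there. The difficulty is at `∂M`, where
`f⁻¹` need not be differentiable.

Each `ρ₀ g` preserves `∂M`, so Hadamard's lemma shows that in charts it multiplies the boundary
coordinate by a `C^r` factor `u`. This factor is positive at the boundary because `ρ₀ g` is a
diffeomorphism (`IsDiffAction.exists_factor`). After conjugation by `Φ` the boundary coordinate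
becomes `f⁻¹ (u · f y)`, while the other coordinates are those of `ρ₀ g (Φ x)` and hence `C^r`.
Along an integral curve of the vector field `f / f'` the value of `f` grows like `eᵗ`, so `f⁻¹ (u ·
f y)` is the time `log u` flow of that field. The field extends to a `C^r` field on `[0,1]`
vanishing at `0`, so its flow is `C^r` up to the boundary (`contDiffWithinAt_flow`).

Hadamard's lemma and the smoothness of the flow are needed both for `C^∞` and for `C^ω`. Both come
from one tool: `γ ↦ w ∘ γ` on continuous curves is as regular as `w` (`contDiffWithinAt_superpose`).
Parameter integrals are then bounded linear operators applied to it, and the flow comes from the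
implicit function theorem in `C([0,1], ℝ)`. -/

/-! ### Superposition operators on spaces of continuous functions -/

section Superposition

variable {X : Type*} [TopologicalSpace X]

/-- The superposition operator `γ ↦ w ∘ γ` on continuous functions (with value `0` when `w ∘ γ` is
not continuous). -/
noncomputable def superpose {V W : Type*} [TopologicalSpace V] [TopologicalSpace W] [Zero W]
    (w : V → W) (γ : C(X, V)) : C(X, W) :=
  open Classical in if h : Continuous (w ∘ γ) then ⟨w ∘ γ, h⟩ else 0

theorem superpose_apply {V W : Type*} [TopologicalSpace V] [TopologicalSpace W] [Zero W]
    {w : V → W} {γ : C(X, V)} (h : Continuous (w ∘ γ)) (s : X) : superpose w γ s = w (γ s) := by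
  simp [superpose, dif_pos h]

theorem superpose_apply_of_continuousOn {V W : Type*} [TopologicalSpace V] [TopologicalSpace W]
    [Zero W] {w : V → W} {K : Set V} (hw : ContinuousOn w K) {γ : C(X, V)} (hγ : ∀ s, γ s ∈ K)
    (s : X) : superpose w γ s = w (γ s) :=
  superpose_apply (hw.comp_continuous γ.continuous hγ) s

variable [CompactSpace X]

/-- The range of `γ` is compact, so one `δ` serves all its points; the second point `z` may be
anywhere in `K`. -/
theorem exists_dist_lt_of_continuousOn {V W : Type*} [PseudoMetricSpace V] [PseudoMetricSpace W]
    {w : V → W} {K : Set V} (hw : ContinuousOn w K) (γ : C(X, V)) (hγ : ∀ s, γ s ∈ K)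
    {ε : ℝ} (hε : 0 < ε) :
    ∃ δ > 0, ∀ s, ∀ z ∈ K, dist (γ s) z < δ → dist (w (γ s)) (w z) < ε := by
  let γ' : X → K := fun s => ⟨γ s, hγ s⟩
  have hγ' : Continuous γ' := γ.continuous.subtype_mk _
  have h := (isCompact_range hγ').uniformContinuousAt_of_continuousAt (K.domRestrict w)
    (fun a _ => (continuousOn_iff_continuous_domRestrict.1 hw).continuousAt)
    (Metric.dist_mem_uniformity hε)
  obtain ⟨δ, hδ, H⟩ := Metric.mem_uniformity_dist.1 h
  refine ⟨δ, hδ, fun s z hz hd => ?_⟩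
  exact H (a := γ' s) (b := ⟨z, hz⟩) hd (mem_range_self s)

theorem continuousOn_superpose {V W : Type*} [NormedAddCommGroup V] [NormedAddCommGroup W]
    {w : V → W} {K : Set V}
    (hw : ContinuousOn w K) :
    ContinuousOn (superpose w) {γ : C(X, V) | ∀ s, γ s ∈ K} := by
  intro γ hγ
  rw [Metric.continuousWithinAt_iff]
  intro ε hε
  obtain ⟨δ, hδ, H⟩ := exists_dist_lt_of_continuousOn hw γ hγ (half_pos hε)
  refine ⟨δ, hδ, fun η hη hd => lt_of_le_of_lt ?_ (half_lt_self hε)⟩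
  rw [ContinuousMap.dist_le (half_pos hε).le]
  intro s
  rw [superpose_apply_of_continuousOn hw hγ, superpose_apply_of_continuousOn hw hη, dist_comm]
  refine (H s _ (hη s) ?_).le
  rw [dist_comm]
  exact (ContinuousMap.dist_apply_le_dist s).trans_lt hd

variable {V : Type*} [NormedAddCommGroup V] [NormedSpace ℝ V]
  {W : Type*} [NormedAddCommGroup W] [NormedSpace ℝ W]

/-- Pointwise application of a continuous family of linear maps. -/
noncomputable def pointwiseApply (X V W : Type*) [TopologicalSpace X] [CompactSpace X]
    [NormedAddCommGroup V] [NormedSpace ℝ V] [NormedAddCommGroup W] [NormedSpace ℝ W] :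
    C(X, V →L[ℝ] W) →L[ℝ] C(X, V) →L[ℝ] C(X, W) :=
  LinearMap.mkContinuous₂
    (LinearMap.mk₂ ℝ
      (fun (A : C(X, V →L[ℝ] W)) (γ : C(X, V)) =>
        (⟨fun s => A s (γ s), A.continuous.clm_apply γ.continuous⟩ : C(X, W)))
      (fun A B γ => by ext; simp) (fun c A γ => by ext; simp)
      (fun A γ η => by ext; simp) (fun c A γ => by ext; simp)) 1
    (fun A γ => by
      rw [one_mul, ContinuousMap.norm_le _ (by positivity)]
      exact fun s => (A s).le_opNorm_of_le (γ.norm_coe_le_norm s) |>.trans (by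
        gcongr; exact A.norm_coe_le_norm s))

@[simp]
theorem pointwiseApply_apply (A : C(X, V →L[ℝ] W)) (γ : C(X, V)) (s : X) :
    pointwiseApply X V W A γ s = A s (γ s) := rfl

/-- The mean value inequality on the convex set `K ∩ ball (γ s) δ` bounds the remainder at `s`, with
a `δ` independent of `s`. -/
theorem hasFDerivWithinAt_superpose {w : V → W} {w' : V → V →L[ℝ] W} {K : Set V}
    (hK : Convex ℝ K) (hw : ∀ v ∈ K, HasFDerivWithinAt w (w' v) K v) (hw' : ContinuousOn w' K)
    {γ : C(X, V)} (hγ : ∀ s, γ s ∈ K) :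
    HasFDerivWithinAt (superpose w) (pointwiseApply X V W (superpose w' γ))
      {γ : C(X, V) | ∀ s, γ s ∈ K} γ := by
  have hwc : ContinuousOn w K := fun v hv => (hw v hv).continuousWithinAt
  rw [hasFDerivWithinAt_iff_isLittleO, Asymptotics.isLittleO_iff]
  intro ε hε
  obtain ⟨δ, hδ, H⟩ := exists_dist_lt_of_continuousOn hw' γ hγ hε
  have hball : Metric.ball γ δ ∈ 𝓝[{γ : C(X, V) | ∀ s, γ s ∈ K}] γ :=
    mem_nhdsWithin_of_mem_nhds (Metric.ball_mem_nhds γ hδ)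
  filter_upwards [hball, self_mem_nhdsWithin] with η hηδ hη
  rw [ContinuousMap.norm_le _ (by positivity)]
  intro s
  have hd : dist (η s) (γ s) < δ := (ContinuousMap.dist_apply_le_dist s).trans_lt hηδ
  have key := (hK.inter (convex_ball (γ s) δ)).norm_image_sub_le_of_norm_hasFDerivWithin_le'
    (f := w) (f' := w') (φ := w' (γ s)) (C := ε) (x := γ s) (y := η s)
    (fun v hv => (hw v hv.1).mono inter_subset_left)
    (fun v hv => by
      rw [← dist_eq_norm, dist_comm]
      exact (H s v hv.1 (by rw [dist_comm]; exact hv.2)).le)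
    ⟨hγ s, Metric.mem_ball_self hδ⟩ ⟨hη s, hd⟩
  simp only [ContinuousMap.sub_apply, pointwiseApply_apply,
    superpose_apply_of_continuousOn hwc hγ, superpose_apply_of_continuousOn hwc hη,
    superpose_apply_of_continuousOn hw' hγ]
  refine key.trans ?_
  gcongr
  exact (η - γ).norm_coe_le_norm s

end Superposition

universe u v

/-- Induction on `k`: the derivative is a superposition operator again, for `fderivWithin ℝ w K`,
followed by a bounded linear map. The target changes from `W` to `V →L[ℝ] W`, hence the
quantification over `W` and the universe `max u v`. -/
theorem contDiffOn_superpose_nat {X : Type*} [TopologicalSpace X] [CompactSpace X]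
    {V : Type u} [NormedAddCommGroup V] [NormedSpace ℝ V] {K : Set V}
    (hK : Convex ℝ K) (hKu : UniqueDiffOn ℝ K) (k : ℕ) :
    ∀ {W : Type (max u v)} [NormedAddCommGroup W] [NormedSpace ℝ W] {w : V → W},
    ContDiffOn ℝ k w K → ContDiffOn ℝ k (superpose w) {γ : C(X, V) | ∀ s, γ s ∈ K} := by
  induction k with
  | zero =>
    intro W _ _ w hw
    rw [Nat.cast_zero, contDiffOn_zero] at hw ⊢
    exact continuousOn_superpose hw
  | succ k ih =>
    intro W _ _ w hw γ hγ
    rw [Nat.cast_succ] at hw ⊢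
    obtain ⟨hd, -, hw'⟩ := (contDiffOn_succ_iff_fderivWithin hKu).1 hw
    refine (contDiffWithinAt_succ_iff_hasFDerivWithinAt (by simp)).2
      ⟨{γ : C(X, V) | ∀ s, γ s ∈ K}, by rw [insert_eq_of_mem hγ]; exact self_mem_nhdsWithin,
      by simp, fun η => pointwiseApply X V W (superpose (fderivWithin ℝ w K) η),
      fun η hη => hasFDerivWithinAt_superpose hK (fun v hv => (hd v hv).hasFDerivWithinAt)
        hw'.continuousOn hη, ?_⟩
    exact (pointwiseApply X V W).contDiff.comp_contDiffWithinAt (ih hw' γ hγ)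

/-! ### Analyticity of superposition operators -/

section Analytic

variable {X : Type*} [TopologicalSpace X] [CompactSpace X]
  {V : Type*} [NormedAddCommGroup V] [NormedSpace ℝ V]
  {W : Type*} [NormedAddCommGroup W] [NormedSpace ℝ W]

/-- The pointwise extension of a multilinear map to continuous functions. -/
noncomputable def pointwiseMultilinear (X : Type*) [TopologicalSpace X] [CompactSpace X] {n : ℕ}
    (p : ContinuousMultilinearMap ℝ (fun _ : Fin n => V) W) :
    ContinuousMultilinearMap ℝ (fun _ : Fin n => C(X, V)) C(X, W) :=
  MultilinearMap.mkContinuous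
    { toFun := fun m => ⟨fun s => p fun i => m i s,
        p.cont.comp (continuous_pi fun i => (m i).continuous)⟩
      map_update_add' := fun m i x y => by
        ext s
        have (z : C(X, V)) : (fun j => Function.update m i z j s) =
            Function.update (fun j => m j s) i (z s) := by
          ext j; by_cases h : j = i
          · subst h; simp
          · simp [h]
        simp only [ContinuousMap.coe_mk, ContinuousMap.add_apply]
        convert p.map_update_add (fun j => m j s) i (x s) (y s) using 2
        · exact this (x + y)
        · congr 1; exact this x
        · congr 1; exact this y
      map_update_smul' := fun m i c x => by
        ext s
        have (z : C(X, V)) : (fun j => Function.update m i z j s) =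
            Function.update (fun j => m j s) i (z s) := by
          ext j; by_cases h : j = i
          · subst h; simp
          · simp [h]
        simp only [ContinuousMap.coe_mk, ContinuousMap.smul_apply]
        convert p.map_update_smul (fun j => m j s) i c (x s) using 2
        · exact this (c • x)
        · congr 1; exact this x }
    ‖p‖ (fun m => by
      rw [ContinuousMap.norm_le _ (by positivity)]
      intro s
      refine (p.le_opNorm _).trans ?_
      gcongr with i
      exact (m i).norm_coe_le_norm s)

theorem norm_pointwiseMultilinear_le {n : ℕ}
    (p : ContinuousMultilinearMap ℝ (fun _ : Fin n => V) W) :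
    ‖pointwiseMultilinear X p‖ ≤ ‖p‖ :=
  MultilinearMap.mkContinuous_norm_le _ (norm_nonneg _) _

/-- At a constant curve, a single power series of `w` applies at every `s`; extending its terms
pointwise does not increase their norms. -/
theorem analyticAt_superpose [CompleteSpace W] {w : V → W} {v₀ : V} (hw : AnalyticAt ℝ w v₀) :
    AnalyticAt ℝ (superpose w) (ContinuousMap.const X v₀) := by
  obtain ⟨p, r, hp⟩ := hw
  let P : FormalMultilinearSeries ℝ C(X, V) C(X, W) := fun n => pointwiseMultilinear X (p n)
  have hrad : p.radius ≤ P.radius :=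
    FormalMultilinearSeries.radius_le_of_le fun n => norm_pointwiseMultilinear_le (p n)
  refine ⟨P, r, hp.r_le.trans hrad, hp.r_pos, fun {η} hη => ?_⟩
  have hmem : ∀ s, η s ∈ Metric.eball (0 : V) r := fun s => by
    rw [Metric.mem_eball, edist_zero_right] at hη ⊢
    refine lt_of_le_of_lt ?_ hη
    rw [enorm_le_iff_norm_le]
    exact η.norm_coe_le_norm s
  have hcont : Continuous (w ∘ (ContinuousMap.const X v₀ + η)) := by
    refine hp.continuousOn.comp_continuous (ContinuousMap.continuous _) fun s => ?_
    have := hmem s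
    simpa [Metric.mem_eball, edist_eq_enorm_sub] using this
  have hsum : Summable fun n => P n fun _ => η := by
    refine P.summable (x := η) ?_
    rw [Metric.mem_eball] at hη ⊢
    exact hη.trans_le (hp.r_le.trans hrad)
  obtain ⟨S, hS⟩ := hsum
  have hSeq : superpose w (ContinuousMap.const X v₀ + η) = S := by
    ext s
    rw [superpose_apply hcont]
    exact (hp.hasSum (hmem s)).unique (hS.mapL (ContinuousMap.evalCLM ℝ s))
  rwa [hSeq]

end Analytic

theorem eventually_forall_apply_mem (X : Type*) [TopologicalSpace X] [CompactSpace X]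
    {V : Type*} [PseudoMetricSpace V] {v₀ : V} {u : Set V} (hu : u ∈ 𝓝 v₀) :
    ∀ᶠ γ in 𝓝 (ContinuousMap.const X v₀), ∀ s, γ s ∈ u := by
  obtain ⟨δ, hδ, hu⟩ := Metric.mem_nhds_iff.1 hu
  filter_upwards [Metric.ball_mem_nhds _ hδ] with γ hγ s
  exact hu ((ContinuousMap.dist_apply_le_dist (f := γ) s).trans_lt hγ)

/-- For finite orders, `S` is intersected with a small ball to keep a convex domain; in the analytic
case, `w` is replaced by an analytic function on a full neighbourhood. Constant curves suffice
because both applications are local near a point. -/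
theorem contDiffWithinAt_superpose {X : Type*} [TopologicalSpace X] [CompactSpace X]
    {V : Type u} [NormedAddCommGroup V] [NormedSpace ℝ V] {S : Set V}
    (hS : Convex ℝ S) (hS' : (interior S).Nonempty)
    {W : Type (max u v)} [NormedAddCommGroup W] [NormedSpace ℝ W] [CompleteSpace W] {w : V → W} {v₀ : V}
    (hv₀ : v₀ ∈ S) {r : WithTop ℕ∞} (hw : ContDiffWithinAt ℝ r w S v₀) :
    ContDiffWithinAt ℝ r (superpose w) {γ : C(X, V) | ∀ s, γ s ∈ S} (ContinuousMap.const X v₀) := by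
  have key : ∀ k : ℕ, ContDiffWithinAt ℝ k w S v₀ →
      ContDiffWithinAt ℝ k (superpose w) {γ : C(X, V) | ∀ s, γ s ∈ S}
        (ContinuousMap.const X v₀) := by
    intro k hk
    obtain ⟨u, hu, -, hwu⟩ := hk.contDiffOn le_rfl (by simp)
    rw [insert_eq_of_mem hv₀] at hu
    obtain ⟨δ, hδ, hsub⟩ := Metric.mem_nhdsWithin_iff.1 hu
    have hKu : UniqueDiffOn ℝ (S ∩ Metric.ball v₀ δ) :=
      (uniqueDiffOn_convex hS hS').inter Metric.isOpen_ball
    have := contDiffOn_superpose_nat (X := X) (hS.inter (convex_ball v₀ δ)) hKu k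
      (hwu.mono (by rwa [inter_comm] at hsub)) (ContinuousMap.const X v₀)
      (fun _ => ⟨hv₀, Metric.mem_ball_self hδ⟩)
    refine this.mono_of_mem_nhdsWithin ?_
    filter_upwards [self_mem_nhdsWithin,
      mem_nhdsWithin_of_mem_nhds (eventually_forall_apply_mem X (Metric.ball_mem_nhds v₀ hδ))] with γ h1 h2 s
    exact ⟨h1 s, h2 s⟩
  match r with
  | ω =>
    rw [contDiffWithinAt_omega_iff_analyticWithinAt,
      analyticWithinAt_iff_exists_analyticAt] at hw ⊢
    rw [insert_eq_of_mem hv₀] at hw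
    rw [insert_eq_of_mem (show ContinuousMap.const X v₀ ∈ {γ : C(X, V) | ∀ s, γ s ∈ S} from
      fun _ => hv₀)]
    obtain ⟨g, hg, hga⟩ := hw
    refine ⟨superpose g, ?_, analyticAt_superpose hga⟩
    obtain ⟨u, hu, hgu⟩ : ∃ u ∈ 𝓝 v₀, ∀ v ∈ u, v ∈ S → w v = g v :=
      ⟨_, eventually_nhdsWithin_iff.1 hg, fun v hv => hv⟩
    filter_upwards [self_mem_nhdsWithin, mem_nhdsWithin_of_mem_nhds (eventually_forall_apply_mem X hu)] with γ h1 h2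
    have heq : w ∘ γ = g ∘ γ := funext fun s => hgu _ (h2 s) (h1 s)
    -- Without continuity both operators take the default value `0`.
    by_cases h : Continuous (g ∘ γ)
    · ext s
      rw [superpose_apply h, superpose_apply (heq ▸ h)]
      exact congrFun heq s
    · rw [superpose, superpose, dif_neg h, dif_neg (heq ▸ h)]
  | ∞ => exact contDiffWithinAt_infty.2 fun k => key k (contDiffWithinAt_infty.1 hw k)
  | (k : ℕ) => exact key k hw

/-! ### The integration operator and division by a linear form -/

section Volterra

open unitInterval

/-- The Volterra operator `γ ↦ (s ↦ ∫₀ˢ γ)` on `C([0,1], ℝ)`. -/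
noncomputable def volterra : C(I, ℝ) →L[ℝ] C(I, ℝ) :=
  LinearMap.mkContinuous
    { toFun := fun γ => ⟨fun s => ∫ τ in (0 : ℝ)..s, γ (projIcc 0 1 zero_le_one τ),
        (intervalIntegral.continuous_primitive (fun a b =>
          (γ.continuous.comp continuous_projIcc).intervalIntegrable a b) 0).comp
          continuous_subtype_val⟩
      map_add' := fun γ η => by
        ext s
        exact intervalIntegral.integral_add
          ((γ.continuous.comp continuous_projIcc).intervalIntegrable _ _)
          ((η.continuous.comp continuous_projIcc).intervalIntegrable _ _)
      map_smul' := fun c γ => by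
        ext s
        exact intervalIntegral.integral_smul c _ }
    1 (fun γ => by
      rw [ContinuousMap.norm_le _ (by positivity), one_mul]
      intro s
      refine (intervalIntegral.norm_integral_le_of_norm_le_const
        (fun τ _ => γ.norm_coe_le_norm _)).trans ?_
      rw [sub_zero, abs_of_nonneg s.2.1]
      exact mul_le_of_le_one_right (norm_nonneg _) s.2.2)

theorem volterra_apply (γ : C(I, ℝ)) (s : I) :
    volterra γ s = ∫ τ in (0 : ℝ)..s, γ (projIcc 0 1 zero_le_one τ) := rfl

theorem volterra_apply_eq_sub {F F' : ℝ → ℝ} {γ : C(I, ℝ)} (hF : ContinuousOn F (Icc 0 1))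
    (hF' : ∀ τ ∈ Ioo (0 : ℝ) 1, HasDerivAt F (F' τ) τ) (hγ : ∀ s : I, γ s = F' s) (s : I) :
    volterra γ s = F s - F 0 := by
  rw [volterra_apply]
  refine intervalIntegral.integral_eq_sub_of_hasDerivAt_of_le s.2.1
    (hF.mono (Icc_subset_Icc_right s.2.2)) (fun τ hτ => ?_)
    ((γ.continuous.comp continuous_projIcc).intervalIntegrable _ _)
  have hτ' : τ ∈ Ioo (0 : ℝ) 1 := ⟨hτ.1, hτ.2.trans_le s.2.2⟩
  rw [projIcc_of_mem zero_le_one (Ioo_subset_Icc_self hτ'), hγ]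
  exact hF' τ hτ'


variable {V : Type u} [NormedAddCommGroup V] [NormedSpace ℝ V]

theorem add_one_le_of_infty_or_omega {r : WithTop ℕ∞} (hr : r = ∞ ∨ r = ω) : r + 1 ≤ r := by
  rcases hr with rfl | rfl <;> exact le_rfl

theorem one_le_of_infty_or_omega {r : WithTop ℕ∞} (hr : r = ∞ ∨ r = ω) : 1 ≤ r := by
  rcases hr with rfl | rfl
  · exact_mod_cast le_top
  · exact le_top

/-- **Hadamard's lemma** on a half-space, with real-analytic regularity allowed. -/
theorem exists_contDiffWithinAt_eq_mul (ℓ : V →L[ℝ] ℝ) {e : V} (he : ℓ e = 1) {Y : V → ℝ} {v₀ : V}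
    (hv₀ : ℓ v₀ = 0) {r : WithTop ℕ∞} (hr : r = ∞ ∨ r = ω)
    (hY : ContDiffWithinAt ℝ r Y {v | 0 ≤ ℓ v} v₀)
    (hY₀ : ∀ᶠ v in 𝓝[{v | 0 ≤ ℓ v}] v₀, ℓ v = 0 → Y v = 0) :
    ∃ u : V → ℝ, ContDiffWithinAt ℝ r u {v | 0 ≤ ℓ v} v₀ ∧
      ∀ᶠ v in 𝓝[{v | 0 ≤ ℓ v}] v₀, Y v = ℓ v * u v := by
  set S : Set V := {v | 0 ≤ ℓ v} with hSdef
  have hv₀S : v₀ ∈ S := hv₀.ge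
  have hSc : Convex ℝ S := convex_halfSpace_ge ℓ.isLinear 0
  have hSi : (interior S).Nonempty :=
    ⟨e, interior_maximal (s := S) (t := {v | 0 < ℓ v}) (fun v (hv : 0 < ℓ v) => show 0 ≤ ℓ v from hv.le)
      (isOpen_lt continuous_const ℓ.continuous) (show 0 < ℓ e by simp [he])⟩
  have hSu : UniqueDiffOn ℝ S := uniqueDiffOn_convex hSc hSi
  set w : V → V →L[ℝ] ℝ := fderivWithin ℝ Y S
  have hw : ContDiffWithinAt ℝ r w S v₀ :=
    hY.fderivWithin_right hSu (add_one_le_of_infty_or_omega hr) hv₀S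
  let c : C(I, V) := ⟨fun s => ((s : ℝ) - 1) • e, by fun_prop⟩
  -- The segment from the projection `v - ℓ v • e` on the hyperplane `ℓ = 0` to `v`. The quotient
  -- will be the integral of the derivative of `Y` in direction `e` along it. At `v₀` the segment is
  -- constant.
  let path : V → C(I, V) := fun v => ContinuousLinearMap.const ℝ I v + ℓ v • c
  have hpath : ContDiff ℝ r path := by
    have := (ContinuousLinearMap.const ℝ I : V →L[ℝ] C(I, V)).contDiff (n := r)
    have := ℓ.contDiff (n := r)
    fun_prop
  have path_apply (v : V) (s : I) : path v s = v + (ℓ v * ((s : ℝ) - 1)) • e := by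
    simp [path, c, smul_smul]
  have hpath₀ : path v₀ = ContinuousMap.const I v₀ := by ext s; simp [path_apply, hv₀]
  have hpathS : MapsTo path S {γ : C(I, V) | ∀ s, γ s ∈ S} := by
    intro v hv s
    simp only [hSdef, mem_ofPred_eq, path_apply, map_add, map_smul, he, smul_eq_mul, mul_one] at hv ⊢
    nlinarith [s.2.1]
  let ev : C(I, V →L[ℝ] ℝ) →L[ℝ] C(I, ℝ) :=
    (ContinuousLinearMap.apply ℝ ℝ e).compLeftContinuous ℝ I
  let L : C(I, V →L[ℝ] ℝ) →L[ℝ] ℝ := (ContinuousMap.evalCLM ℝ (1 : I)).comp (volterra.comp ev)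
  refine ⟨fun v => L (superpose w (path v)), ?_, ?_⟩
  · refine (L.contDiff (n := r)).comp_contDiffWithinAt (ContDiffWithinAt.comp (g := superpose w) v₀ ?_
      hpath.contDiffWithinAt hpathS)
    rw [hpath₀]
    exact contDiffWithinAt_superpose hSc hSi hv₀S hw
  obtain ⟨u, hu, -, hYu⟩ := hY.contDiffOn (one_le_of_infty_or_omega hr) (by simp)
  obtain ⟨u', hu', -, hwu⟩ := hw.contDiffOn (m := 0) zero_le (by simp)
  rw [insert_eq_of_mem hv₀S] at hu hu'
  obtain ⟨O, hO, hOsub⟩ := mem_nhdsWithin_iff_exists_mem_nhds_inter.1 (inter_mem hu hu')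
  obtain ⟨O', hO'⟩ := mem_nhds_iff.1 hO
  have hO'O : O' ∩ S ⊆ u ∩ u' := fun v hv => hOsub ⟨hO'.1 hv.1, hv.2⟩
  have hnear : ∀ᶠ v in 𝓝[S] v₀, ∀ s, path v s ∈ O' := by
    have := eventually_forall_apply_mem I (hO'.2.1.mem_nhds hO'.2.2)
    rw [← hpath₀] at this
    exact (hpath.continuous.tendsto v₀).eventually this |>.filter_mono nhdsWithin_le_nhds
  have hzero : ∀ᶠ v in 𝓝[S] v₀, Y (path v 0) = 0 := by
    have htend : Tendsto (fun v => path v 0) (𝓝[S] v₀) (𝓝[S] v₀) := by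
      refine tendsto_nhdsWithin_iff.2 ⟨?_, ?_⟩
      · have : Continuous fun v => path v 0 :=
          (ContinuousMap.evalCLM ℝ (0 : I)).continuous.comp hpath.continuous
        have h := this.tendsto v₀
        simp only [hpath₀, ContinuousMap.const_apply] at h
        exact h.mono_left nhdsWithin_le_nhds
      · filter_upwards [self_mem_nhdsWithin] with v hv using hpathS hv 0
    filter_upwards [htend.eventually hY₀] with v hv
    exact hv (by simp [path_apply, he])
  filter_upwards [hnear, hzero, self_mem_nhdsWithin] with v hvO hv0 hvS
  let q : ℝ → V := fun τ => v + (ℓ v * (τ - 1)) • e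
  have hq (τ : ℝ) (hτ : τ ∈ Icc (0 : ℝ) 1) : q τ ∈ O' ∩ S := by
    have h1 := hvO ⟨τ, hτ⟩
    have h2 := hpathS hvS ⟨τ, hτ⟩
    rw [path_apply] at h1 h2
    exact ⟨h1, h2⟩
  have hdiff : ∀ z ∈ O' ∩ S, HasFDerivWithinAt Y (w z) (O' ∩ S) z := by
    intro z hz
    have h1 : DifferentiableWithinAt ℝ Y (O' ∩ S) z :=
      ((hYu.mono (hO'O.trans inter_subset_left)).differentiableOn (by simp)) z hz
    have h2 : DifferentiableWithinAt ℝ Y S z := by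
      rwa [inter_comm, differentiableWithinAt_inter (hO'.2.1.mem_nhds hz.1)] at h1
    exact h2.hasFDerivWithinAt.mono inter_subset_right
  have hqd (τ : ℝ) : HasDerivAt q (ℓ v • e) τ := by
    have := (((hasDerivAt_id τ).sub_const 1).const_mul (ℓ v)).smul_const e |>.const_add v
    simpa [q] using this
  have hFd : ∀ τ ∈ Icc (0 : ℝ) 1,
      HasDerivWithinAt (Y ∘ q) (w (q τ) (ℓ v • e)) (Icc 0 1) τ := fun τ hτ =>
    (hdiff _ (hq τ hτ)).comp_hasDerivWithinAt τ (hqd τ).hasDerivWithinAt hq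
  have hsup (s : I) : superpose w (path v) s = w (q s) := by
    rw [superpose_apply_of_continuousOn (hwu.continuousOn.mono (hO'O.trans inter_subset_right))
      (fun s => ⟨hvO s, hpathS hvS s⟩), path_apply]
  have key := volterra_apply_eq_sub (F := Y ∘ q) (F' := fun τ => w (q τ) (ℓ v • e))
    (γ := ℓ v • ev (superpose w (path v))) (fun τ hτ => (hFd τ hτ).continuousWithinAt)
    (fun τ hτ => (hFd τ (Ioo_subset_Icc_self hτ)).hasDerivAt (Icc_mem_nhds hτ.1 hτ.2))
    (fun s => by
      rw [ContinuousMap.smul_apply, map_smul, ← hsup]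
      rfl) 1
  have hq0 : q 0 = path v 0 := by simp [q, path_apply]
  have hq1 : q 1 = v := by simp [q]
  rw [map_smul, ContinuousMap.smul_apply, smul_eq_mul] at key
  simp only [Function.comp_apply, Icc.coe_one, hq0, hq1, hv0, sub_zero] at key
  rw [← key]
  rfl

end Volterra

/-! ### The flow `(t, y) ↦ f⁻¹ (eᵗ f y)` of the vector field `f / f'` -/

/-- A `C^k` function on `[0,1]` extends to a `C^k` function on the line. -/
theorem exists_contDiff_eqOn_Icc (k : ℕ) : ∀ {h : ℝ → ℝ}, ContDiffOn ℝ k h (Icc 0 1) →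
    ∃ H : ℝ → ℝ, ContDiff ℝ k H ∧ EqOn H h (Icc 0 1) := by
  induction k with
  | zero =>
    intro h hh
    rw [Nat.cast_zero, contDiffOn_zero] at hh
    exact ⟨IccExtend zero_le_one ((Icc (0 : ℝ) 1).domRestrict h), by
      rw [Nat.cast_zero, contDiff_zero]
      exact (continuousOn_iff_continuous_domRestrict.1 hh).Icc_extend',
      fun y hy => IccExtend_of_mem _ _ hy⟩
  | succ k ih =>
    intro h hh
    rw [Nat.cast_succ] at hh ⊢
    obtain ⟨hd, -, hh'⟩ :=
      (contDiffOn_succ_iff_derivWithin (uniqueDiffOn_Icc zero_lt_one)).1 hh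
    obtain ⟨H', hH', hHeq⟩ := ih hh'
    -- The extension is a primitive of an extension of the derivative.
    have hder (y : ℝ) : HasDerivAt (fun y => h 0 + ∫ τ in (0 : ℝ)..y, H' τ) (H' y) y :=
      (hH'.continuous.integral_hasStrictDerivAt 0 y).hasDerivAt.const_add _
    refine ⟨fun y => h 0 + ∫ τ in (0 : ℝ)..y, H' τ, ?_, fun y hy => ?_⟩
    · rw [contDiff_succ_iff_deriv]
      refine ⟨fun y => (hder y).differentiableAt, by simp, ?_⟩
      rwa [show deriv (fun y => h 0 + ∫ τ in (0 : ℝ)..y, H' τ) = H' from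
        funext fun y => (hder y).deriv]
    · have := intervalIntegral.integral_eq_sub_of_hasDerivAt_of_le hy.1
        (hh.continuousOn.mono (Icc_subset_Icc_right hy.2)) (f' := H') (fun τ hτ => ?_)
        (hH'.continuous.intervalIntegrable _ _)
      · simp [this]
      · have hτ' : τ ∈ Ioo (0 : ℝ) 1 := ⟨hτ.1, hτ.2.trans_le hy.2⟩
        rw [hHeq (Ioo_subset_Icc_self hτ')]
        exact (hd τ (Ioo_subset_Icc_self hτ')).hasDerivWithinAt.hasDerivAt
          (Icc_mem_nhds hτ'.1 hτ'.2)

/-- The inverse of a stretching function. -/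
noncomputable def stretchInv (f : ℝ → ℝ) : ℝ → ℝ := Function.invFunOn f (Icc 0 1)

/-- The flow of `f / f'`. -/
noncomputable def stretchFlow (f : ℝ → ℝ) (p : ℝ × ℝ) : ℝ := stretchInv f (Real.exp p.1 * f p.2)

namespace IsStretchingFunction

variable {r : WithTop ℕ∞} {f : ℝ → ℝ}

theorem inv_mem (hf : IsStretchingFunction r f) {z : ℝ} (hz : z ∈ Icc (0 : ℝ) 1) :
    stretchInv f z ∈ Icc (0 : ℝ) 1 :=
  Function.invFunOn_mem (hf.bijOn.surjOn hz)

theorem apply_inv (hf : IsStretchingFunction r f) {z : ℝ} (hz : z ∈ Icc (0 : ℝ) 1) :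
    f (stretchInv f z) = z :=
  Function.invFunOn_eq (hf.bijOn.surjOn hz)

theorem inv_apply (hf : IsStretchingFunction r f) {y : ℝ} (hy : y ∈ Icc (0 : ℝ) 1) :
    stretchInv f (f y) = y :=
  hf.bijOn.injOn.leftInvOn_invFunOn hy

theorem map_zero (hf : IsStretchingFunction r f) : f 0 = 0 := by
  have h0 : (0 : ℝ) ∈ Icc (0 : ℝ) 1 := ⟨le_rfl, zero_le_one⟩
  obtain ⟨a, ha, hfa⟩ := hf.bijOn.surjOn h0
  exact le_antisymm (hfa ▸ hf.strictMonoOn.monotoneOn h0 ha ha.1) (hf.bijOn.mapsTo h0).1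

theorem pos (hf : IsStretchingFunction r f) {y : ℝ} (hy : y ∈ Ioc (0 : ℝ) 1) : 0 < f y := by
  have := hf.strictMonoOn (a := 0) (b := y) ⟨le_rfl, zero_le_one⟩ ⟨hy.1.le, hy.2⟩ hy.1
  rwa [hf.map_zero] at this

theorem inv_zero (hf : IsStretchingFunction r f) : stretchInv f 0 = 0 := by
  conv_lhs => rw [← hf.map_zero]
  exact hf.inv_apply ⟨le_rfl, zero_le_one⟩

theorem inv_lt (hf : IsStretchingFunction r f) {y z : ℝ} (hy : y ∈ Icc (0 : ℝ) 1) (hz : 0 ≤ z)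
    (h : z < f y) : stretchInv f z < y := by
  have hz1 : z ∈ Icc (0 : ℝ) 1 := ⟨hz, h.le.trans (hf.bijOn.mapsTo hy).2⟩
  rw [← hf.strictMonoOn.lt_iff_lt (hf.inv_mem hz1) hy, hf.apply_inv hz1]
  exact h

theorem inv_pos (hf : IsStretchingFunction r f) {z : ℝ} (hz : z ∈ Ioc (0 : ℝ) 1) :
    0 < stretchInv f z := by
  have hz' : z ∈ Icc (0 : ℝ) 1 := ⟨hz.1.le, hz.2⟩
  refine (hf.inv_mem hz').1.lt_of_ne fun h => hz.1.ne ?_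
  rw [← hf.apply_inv hz', ← h, hf.map_zero]

theorem hasDerivAt (hf : IsStretchingFunction r f) (hr : 1 ≤ r) {y : ℝ}
    (hy : y ∈ Ioo (0 : ℝ) 1) : HasDerivAt f (derivWithin f (Icc 0 1) y) y :=
  ((hf.contDiffOn.differentiableOn (by rintro rfl; simp at hr) y
    (Ioo_subset_Icc_self hy)).hasDerivWithinAt).hasDerivAt (Icc_mem_nhds hy.1 hy.2)

/-- Differentiability of the inverse is given; the chain rule for `f ∘ f⁻¹ = id` then forces `f' ≠
0`. -/
theorem hasDerivAt_inv (hf : IsStretchingFunction r f) (hr : 1 ≤ r) {z : ℝ}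
    (hz : z ∈ Ioo (0 : ℝ) 1) :
    derivWithin f (Icc 0 1) (stretchInv f z) ≠ 0 ∧
    HasDerivAt (stretchInv f) (derivWithin f (Icc 0 1) (stretchInv f z))⁻¹ z := by
  obtain ⟨g, -, hg, hinv, hgc⟩ := hf.exists_inverse
  have heq : EqOn (stretchInv f) g (Ioc 0 1) := fun x hx => by
    conv_lhs => rw [← hinv.2 hx]
    exact hf.inv_apply (Ioc_subset_Icc_self (hg hx))
  have hnhds : Ioc (0 : ℝ) 1 ∈ 𝓝 z := Ioc_mem_nhds hz.1 hz.2
  have hd : DifferentiableAt ℝ (stretchInv f) z :=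
    (((hgc z ⟨hz.1, hz.2.le⟩).contDiffAt hnhds).differentiableAt
      (by rintro rfl; simp at hr)).congr_of_eventuallyEq (heq.eventuallyEq_of_mem hnhds)
  have hz' : z ∈ Icc (0 : ℝ) 1 := Ioo_subset_Icc_self hz
  have hy : stretchInv f z ∈ Ioo (0 : ℝ) 1 := by
    refine ⟨hf.inv_pos ⟨hz.1, hz.2.le⟩, (hf.inv_mem hz').2.lt_of_ne fun h => hz.2.ne ?_⟩
    obtain ⟨a, ha, hfa⟩ := hf.bijOn.surjOn (show (1 : ℝ) ∈ Icc (0 : ℝ) 1 from ⟨zero_le_one, le_rfl⟩)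
    have h1 : f 1 = z := by rw [← h, hf.apply_inv hz']
    have h2 := hf.strictMonoOn.monotoneOn ha ⟨zero_le_one, le_rfl⟩ ha.2
    exact le_antisymm hz.2.le (by linarith)
  have hcomp := (hf.hasDerivAt hr hy).comp z hd.hasDerivAt
  have hid : HasDerivAt (f ∘ stretchInv f) 1 z :=
    (hasDerivAt_id z).congr_of_eventuallyEq (by
      filter_upwards [hnhds] with x hx
      exact hf.apply_inv (Ioc_subset_Icc_self hx))
  have hmul := hcomp.unique hid
  have hne := left_ne_zero_of_mul_eq_one hmul
  refine ⟨hne, ?_⟩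
  rw [← eq_inv_of_mul_eq_one_right hmul]
  exact hd.hasDerivAt

/-- The extension of `f / f'` vanishes at `0`. -/
theorem extension_zero (hf : IsStretchingFunction r f) (hr : 1 ≤ r) {h : ℝ → ℝ}
    (hc : ContDiffOn ℝ r h (Icc 0 1))
    (hh : ∀ y ∈ Ioc (0 : ℝ) 1, h y = f y / derivWithin f (Icc 0 1) y) : h 0 = 0 := by
  have hder (y : ℝ) (hy : y ∈ Ioo (0 : ℝ) 1) : 0 < derivWithin f (Icc 0 1) y := by
    have hfy : f y ∈ Ioo (0 : ℝ) 1 := by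
      refine ⟨hf.pos ⟨hy.1, hy.2.le⟩, ?_⟩
      exact (hf.strictMonoOn (Ioo_subset_Icc_self hy) ⟨zero_le_one, le_rfl⟩ hy.2).trans_le
        (hf.bijOn.mapsTo ⟨zero_le_one, le_rfl⟩).2
    have h1 := (hf.hasDerivAt_inv hr hfy).1
    rw [hf.inv_apply (Ioo_subset_Icc_self hy)] at h1
    exact (hf.strictMonoOn.monotoneOn.derivWithin_nonneg).lt_of_ne' h1
  have h0 : (0 : ℝ) ∈ Icc (0 : ℝ) 1 := ⟨le_rfl, zero_le_one⟩
  have hcont := hc.continuousOn 0 h0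
  by_contra hne
  have hIoo : Ioo (0 : ℝ) 1 ∈ 𝓝[>] (0 : ℝ) := Ioo_mem_nhdsGT zero_lt_one
  have hlim : Tendsto h (𝓝[>] 0) (𝓝 (h 0)) :=
    hcont.tendsto.mono_left (nhdsWithin_le_of_mem (mem_of_superset hIoo Ioo_subset_Icc_self))
  have hpos : 0 < h 0 := by
    refine lt_of_le_of_ne (ge_of_tendsto hlim ?_) (Ne.symm hne)
    filter_upwards [hIoo] with y hy
    rw [hh y ⟨hy.1, hy.2.le⟩]
    exact div_nonneg (hf.pos ⟨hy.1, hy.2.le⟩).le (hder y hy).le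
  have hev : ∀ᶠ y in 𝓝[>] (0 : ℝ), h 0 / 2 < h y ∧ y < 1 :=
    (hlim.eventually (lt_mem_nhds (half_lt_self hpos))).and
      (mem_of_superset hIoo fun y hy => hy.2)
  obtain ⟨δ, hδ0, hδ⟩ := mem_nhdsGT_iff_exists_Ioc_subset.1 hev
  have hδ0 : 0 < δ := hδ0
  have hδ1 : δ < 1 := (hδ (right_mem_Ioc.2 hδ0)).2
  -- If `h 0 > 0`, then `f' ≤ C f` near `0`, so `e^{-Cy} f y` is nonincreasing from the value `0`,
  -- against `f > 0`.
  set C := 2 / h 0 with hC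
  have hanti : AntitoneOn (fun y => Real.exp (-(C * y)) * f y) (Icc 0 δ) := by
    refine antitoneOn_of_deriv_nonpos (convex_Icc 0 δ) ?_ ?_ ?_
    · exact (Continuous.continuousOn (by fun_prop)).mul
        (hf.continuousOn.mono (Icc_subset_Icc_right hδ1.le))
    all_goals
      rw [interior_Icc]
      intro y hy
      have hy1 : y ∈ Ioo (0 : ℝ) 1 := ⟨hy.1, hy.2.trans hδ1⟩
      have hE : HasDerivAt (fun y => Real.exp (-(C * y))) (Real.exp (-(C * y)) * (-C)) y := by
        simpa using (((hasDerivAt_id y).const_mul C).neg).exp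
      have hD := hE.mul (hf.hasDerivAt hr hy1)
    · exact hD.differentiableAt.differentiableWithinAt
    · have hlt := (hδ ⟨hy.1, hy.2.le⟩).1
      rw [hh y ⟨hy.1, hy1.2.le⟩, lt_div_iff₀ (hder y hy1)] at hlt
      rw [show (fun y => Real.exp (-(C * y)) * f y) =
        (fun y => Real.exp (-(C * y))) * f from rfl, hD.deriv]
      have : derivWithin f (Icc 0 1) y ≤ C * f y := by
        rw [hC, div_mul_eq_mul_div, le_div_iff₀ hpos]
        linarith
      nlinarith [Real.exp_pos (-(C * y))]
  have := hanti (left_mem_Icc.2 hδ0.le) (right_mem_Icc.2 hδ0.le) hδ0.le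
  simp only [hf.map_zero, mul_zero] at this
  exact absurd this (not_le.2 (mul_pos (Real.exp_pos _) (hf.pos ⟨hδ0, hδ1.le⟩)))

end IsStretchingFunction

/-! ### Regularity of the flow at the boundary -/

open unitInterval in
/-- Implicit function theorem for the integral equation `γ = y + T ∫ H ∘ γ` near `γ = 0`. -/
theorem exists_contDiffAt_integral_equation {H : ℝ → ℝ} {k : WithTop ℕ∞} (hk : k ≠ 0)
    (hH : ContDiffAt ℝ k H 0) :
    ∃ ψ : ℝ × ℝ → ℝ, ContDiffAt ℝ k ψ 0 ∧ ∀ᶠ v : (ℝ × ℝ) × C(I, ℝ) in 𝓝 0,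
      v.2 = ContinuousMap.const I v.1.2 + v.1.1 • volterra (superpose H v.2) → ψ v.1 = v.2 1 := by
  have hN : ContDiffAt ℝ k (superpose H : C(I, ℝ) → C(I, ℝ)) 0 := by
    have := contDiffWithinAt_superpose (X := I) (S := univ) convex_univ (by simp) (mem_univ (0 : ℝ))
      (contDiffWithinAt_univ.2 hH)
    simp only [mem_univ, implies_true] at this
    exact contDiffWithinAt_univ.1 (by simpa using this)
  let F : (ℝ × ℝ) × C(I, ℝ) → C(I, ℝ) := fun v =>
    v.2 - ContinuousLinearMap.const ℝ I v.1.2 - v.1.1 • volterra (superpose H v.2)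
  have hN2 : ContDiffAt ℝ k (fun v : (ℝ × ℝ) × C(I, ℝ) => superpose H v.2) 0 :=
    ContDiffAt.comp (g := superpose H) 0 hN contDiffAt_snd
  have hN3 : ContDiffAt ℝ k (fun v : (ℝ × ℝ) × C(I, ℝ) => volterra (superpose H v.2)) 0 :=
    volterra.contDiff.contDiffAt.comp 0 hN2
  have hc : ContDiffAt ℝ k
      (fun v : (ℝ × ℝ) × C(I, ℝ) => (ContinuousLinearMap.const ℝ I v.1.2 : C(I, ℝ))) 0 :=
    (ContinuousLinearMap.const ℝ I : ℝ →L[ℝ] C(I, ℝ)).contDiff.contDiffAt.comp 0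
      (contDiffAt_snd.comp 0 contDiffAt_fst)
  have hF : ContDiffAt ℝ k F 0 :=
    (contDiffAt_snd.sub hc).sub ((contDiffAt_fst.comp 0 contDiffAt_fst).smul hN3)
  have hF0 : F 0 = 0 := by
    have : (ContinuousLinearMap.const ℝ I : ℝ →L[ℝ] C(I, ℝ)) 0 = 0 := map_zero _
    simp [F, this]
  -- For `T = 0` and `y = 0` the map `γ ↦ F` is the identity.
  have hinv : (fderiv ℝ F 0 ∘L .inr ℝ (ℝ × ℝ) C(I, ℝ)) = ContinuousLinearMap.id ℝ C(I, ℝ) := by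
    have h1 : HasFDerivAt (F ∘ ContinuousLinearMap.inr ℝ (ℝ × ℝ) C(I, ℝ))
        (fderiv ℝ F 0 ∘L .inr ℝ (ℝ × ℝ) C(I, ℝ)) 0 := by
      refine HasFDerivAt.comp 0 ?_ (ContinuousLinearMap.hasFDerivAt _)
      rw [map_zero]
      exact (hF.differentiableAt hk).hasFDerivAt
    have h2 : F ∘ ContinuousLinearMap.inr ℝ (ℝ × ℝ) C(I, ℝ) = id := by
      funext γ
      have : (ContinuousLinearMap.const ℝ I : ℝ →L[ℝ] C(I, ℝ)) 0 = 0 := map_zero _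
      simp [F, this]
    rw [h2] at h1
    exact h1.unique (hasFDerivAt_id 0)
  have if₂ : (fderiv ℝ F 0 ∘L .inr ℝ (ℝ × ℝ) C(I, ℝ)).IsInvertible := by
    rw [hinv]; exact ⟨ContinuousLinearEquiv.refl ℝ _, rfl⟩
  refine ⟨fun p => ContinuousMap.evalCLM ℝ (1 : I) (hF.implicitFunction hk if₂ p),
    (ContinuousMap.evalCLM ℝ (1 : I) : C(I, ℝ) →L[ℝ] ℝ).contDiff.contDiffAt.comp 0
      (hF.contDiffAt_implicitFunction hk if₂), ?_⟩
  filter_upwards [hF.eventually_apply_eq_iff_implicitFunction hk if₂] with v hv heq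
  have hFv : F v = F 0 := by
    rw [hF0]
    simp only [F]
    nth_rewrite 1 [heq]
    have : (ContinuousLinearMap.const ℝ I v.1.2 : C(I, ℝ)) = ContinuousMap.const I v.1.2 := rfl
    rw [this]
    abel
  rw [hv.1 hFv]
  rfl

namespace IsStretchingFunction

variable {r : WithTop ℕ∞} {f : ℝ → ℝ}

theorem flow_zero_right (hf : IsStretchingFunction r f) (t : ℝ) : stretchFlow f (t, 0) = 0 := by
  simp [stretchFlow, hf.map_zero, hf.inv_zero]

theorem eventually_exp_mul_lt (hf : IsStretchingFunction r f) (C : ℝ) {y : ℝ}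
    (hy : y ∈ Ioc (0 : ℝ) 1) :
    ∀ᶠ z in 𝓝[≥] (0 : ℝ), z ∈ Icc (0 : ℝ) 1 ∧ Real.exp C * f z < f y := by
  have hI : Icc (0 : ℝ) 1 ∈ 𝓝[≥] (0 : ℝ) := Icc_mem_nhdsGE zero_lt_one
  have h : Tendsto (fun z => Real.exp C * f z) (𝓝[≥] 0) (𝓝 (Real.exp C * f 0)) :=
    ((hf.continuousOn 0 ⟨le_rfl, zero_le_one⟩).tendsto.mono_left
      (nhdsWithin_le_of_mem hI)).const_mul _
  rw [hf.map_zero, mul_zero] at h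
  exact (eventually_mem_set.2 hI).and (h.eventually (gt_mem_nhds (hf.pos hy)))

theorem hasDerivAt_flow (hf : IsStretchingFunction r f) (hr : 1 ≤ r) {h : ℝ → ℝ}
    (hh : ∀ y ∈ Ioc (0 : ℝ) 1, h y = f y / derivWithin f (Icc 0 1) y) {T τ y : ℝ}
    (hy : y ∈ Ioc (0 : ℝ) 1) (hlt : Real.exp (T * τ) * f y < 1) :
    HasDerivAt (fun τ => stretchFlow f (T * τ, y)) (T * h (stretchFlow f (T * τ, y))) τ := by
  have hz : Real.exp (T * τ) * f y ∈ Ioo (0 : ℝ) 1 :=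
    ⟨mul_pos (Real.exp_pos _) (hf.pos hy), hlt⟩
  have h1 := (hf.hasDerivAt_inv hr hz).2
  have h2 : HasDerivAt (fun τ => Real.exp (T * τ) * f y) (Real.exp (T * τ) * T * f y) τ := by
    simpa using ((((hasDerivAt_id τ).const_mul T).exp).mul_const (f y))
  have h3 := h1.comp τ h2
  have hpos : stretchFlow f (T * τ, y) ∈ Ioc (0 : ℝ) 1 :=
    ⟨hf.inv_pos (Ioo_subset_Ioc_self hz), (hf.inv_mem (Ioo_subset_Icc_self hz)).2⟩
  rw [hh _ hpos]
  have hfa : f (stretchFlow f (T * τ, y)) = Real.exp (T * τ) * f y :=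
    hf.apply_inv (Ioo_subset_Icc_self hz)
  rw [hfa]
  refine h3.congr_deriv ?_
  simp only [stretchFlow]
  ring

open unitInterval in
-- For small `(T, y)`, the rescaled trajectory `s ↦ stretchFlow f (T * s, y)` on `[0,1]` solves the
-- integral equation and is itself small. The local uniqueness in the implicit function theorem
-- identifies it with the `C^k` solution. `H` replaces `h` because that theorem needs a two-sided
-- neighbourhood of `0`.
theorem contDiffWithinAt_flow_zero (hf : IsStretchingFunction r f) (hr : 1 ≤ r) {h H : ℝ → ℝ}
    (hc : ContDiffOn ℝ r h (Icc 0 1))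
    (hh : ∀ y ∈ Ioc (0 : ℝ) 1, h y = f y / derivWithin f (Icc 0 1) y) {k : WithTop ℕ∞} (hk : k ≠ 0)
    (hH : ContDiffAt ℝ k H 0) (hHh : H =ᶠ[𝓝[Icc 0 1] 0] h) :
    ContDiffWithinAt ℝ k (stretchFlow f) (univ ×ˢ Ici 0) (0, 0) := by
  have hH0 : H 0 = 0 := by
    rw [hHh.eq_of_nhdsWithin ⟨le_rfl, zero_le_one⟩, hf.extension_zero hr hc hh]
  obtain ⟨ψ, hψ, hev⟩ := exists_contDiffAt_integral_equation hk hH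
  have hHc : ∀ᶠ y in 𝓝 (0 : ℝ), ContinuousAt H y :=
    ((hH.of_le (ENat.one_le_iff_ne_zero_withTop.2 hk)).eventually (by simp)).mono
      fun y hy => hy.continuousAt
  obtain ⟨ε₁, hε₁, h₁⟩ := Metric.eventually_nhds_iff.1 hev
  obtain ⟨ε₂, hε₂, h₂⟩ := Metric.eventually_nhds_iff.1
    (hHc.and (eventually_nhdsWithin_iff.1 hHh))
  obtain ⟨ε, hε0, hε⟩ := exists_between (lt_min (lt_min hε₁ hε₂) zero_lt_one)
  have hε₁' : ε < ε₁ := hε.trans_le ((min_le_left _ _).trans (min_le_left _ _))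
  have hε₂' : ε < ε₂ := hε.trans_le ((min_le_left _ _).trans (min_le_right _ _))
  have hε1 : ε < 1 := hε.trans_le (min_le_right _ _)
  have hεm : ε ∈ Icc (0 : ℝ) 1 := ⟨hε0.le, hε1.le⟩
  have hmem : ((0, 0) : ℝ × ℝ) ∈ (univ ×ˢ Ici 0 : Set (ℝ × ℝ)) := by simp
  refine hψ.contDiffWithinAt.congr_of_eventuallyEq_of_mem ?_ hmem
  -- As `|T| < ε < 1`, the factor `e` dominates `e^{Tτ}` and keeps the whole trajectory below `ε`.
  have hev2 : ∀ᶠ p : ℝ × ℝ in 𝓝[univ ×ˢ Ici 0] (0, 0),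
      p.2 ∈ Icc (0 : ℝ) 1 ∧ Real.exp 1 * f p.2 < f ε := by
    have : Tendsto Prod.snd (𝓝[univ ×ˢ Ici 0] ((0, 0) : ℝ × ℝ)) (𝓝[≥] (0 : ℝ)) := by
      rw [nhdsWithin_prod_eq]
      exact tendsto_snd
    exact this.eventually (hf.eventually_exp_mul_lt 1 ⟨hε0, hε1.le⟩)
  filter_upwards [hev2, mem_nhdsWithin_of_mem_nhds (Metric.ball_mem_nhds _ hε0)] with p hp hpε
  obtain ⟨T, y⟩ := p
  obtain ⟨hy, hlt⟩ := hp
  simp only at hy hlt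
  rw [Metric.mem_ball, Prod.dist_eq, max_lt_iff, Real.dist_eq, Real.dist_eq] at hpε
  simp only [Prod.fst_zero, Prod.snd_zero, sub_zero] at hpε
  obtain ⟨hT, hyε⟩ := hpε
  have hfy : 0 ≤ f y := (hf.bijOn.mapsTo hy).1
  have hbound : ∀ τ ∈ Icc (0 : ℝ) 1, Real.exp (T * τ) * f y < f ε := fun τ hτ => by
    refine lt_of_le_of_lt ?_ hlt
    gcongr
    nlinarith [abs_lt.1 hT, hτ.1, hτ.2]
  have hfε : f ε ≤ 1 := (hf.bijOn.mapsTo hεm).2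
  have hflow : ∀ τ ∈ Icc (0 : ℝ) 1, stretchFlow f (T * τ, y) ∈ Ico 0 ε := fun τ hτ =>
    ⟨(hf.inv_mem ⟨by positivity, (hbound τ hτ).le.trans hfε⟩).1,
      hf.inv_lt hεm (by positivity) (hbound τ hτ)⟩
  have hder : ∀ τ ∈ Icc (0 : ℝ) 1, HasDerivAt (fun τ => stretchFlow f (T * τ, y))
      (T * H (stretchFlow f (T * τ, y))) τ := by
    intro τ hτ
    -- The trajectory of `0` is constant, and solves the equation because `H 0 = 0`.
    rcases hy.1.eq_or_lt with rfl | hy0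
    · simp only [hf.flow_zero_right, hH0, mul_zero]
      exact hasDerivAt_const _ _
    · have hb := hflow τ hτ
      have hHx : H (stretchFlow f (T * τ, y)) = h (stretchFlow f (T * τ, y)) :=
        (h₂ (by rw [Real.dist_eq, sub_zero, abs_of_nonneg hb.1]; exact hb.2.trans hε₂')).2
          ⟨hb.1, (hb.2.trans hε1).le⟩
      rw [hHx]
      exact hf.hasDerivAt_flow hr hh ⟨hy0, hy.2⟩ ((hbound τ hτ).trans_le hfε)
  have hcont : ContinuousOn (fun τ => stretchFlow f (T * τ, y)) (Icc 0 1) := fun τ hτ =>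
    (hder τ hτ).continuousAt.continuousWithinAt
  let γ : C(I, ℝ) := ⟨fun s => stretchFlow f (T * s, y),
    continuousOn_iff_continuous_domRestrict.1 hcont⟩
  have hγ_apply (s : I) : γ s = stretchFlow f (T * s, y) := rfl
  have hHγ : Continuous (H ∘ γ) := by
    rw [continuous_iff_continuousAt]
    intro s
    have hb := hflow s s.2
    refine ContinuousAt.comp (g := H) ?_ γ.continuous.continuousAt
    exact (h₂ (by
      rw [Real.dist_eq, sub_zero]
      exact (abs_of_nonneg hb.1).trans_lt (hb.2.trans hε₂'))).1
  have h0 : stretchFlow f (T * 0, y) = y := by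
    simp [stretchFlow, hf.inv_apply hy]
  have hγeq : γ = ContinuousMap.const I y + T • volterra (superpose H γ) := by
    ext s
    have := volterra_apply_eq_sub (γ := T • superpose H γ) hcont
      (fun τ hτ => hder τ (Ioo_subset_Icc_self hτ))
      (fun s => by rw [ContinuousMap.smul_apply, superpose_apply hHγ]; rfl) s
    rw [map_smul, h0] at this
    rw [ContinuousMap.add_apply, this, hγ_apply]
    simp
  have hγε : ‖γ‖ ≤ ε := by
    rw [ContinuousMap.norm_le _ hε0.le]
    intro s
    have hb := hflow s s.2
    exact ((abs_of_nonneg hb.1).trans_lt hb.2).le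
  have := h₁ (y := ((T, y), γ)) (by
    rw [dist_zero_right, Prod.norm_def, Prod.norm_def]
    exact max_lt (max_lt (hT.trans hε₁') (hyε.trans hε₁')) (hγε.trans_lt hε₁')) hγeq
  rw [this, hγ_apply]
  simp

/-- By the group law, the time `t` flow is the `N`-fold iterate of the time `t / N` flow, and `0` is
fixed. Regularity at `(0, 0)` spreads to `(t / N, 0)` for some large `N`; this openness is what
requires `k ≠ ∞`. -/
theorem contDiffWithinAt_flow_of_zero (hf : IsStretchingFunction r f) {k : WithTop ℕ∞}
    (hk : k ≠ ∞) (h0 : ContDiffWithinAt ℝ k (stretchFlow f) (univ ×ˢ Ici 0) (0, 0)) (t : ℝ) :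
    ContDiffWithinAt ℝ k (stretchFlow f) (univ ×ˢ Ici 0) (t, 0) := by
  have hmem (t : ℝ) : ((t, 0) : ℝ × ℝ) ∈ (univ ×ˢ Ici 0 : Set (ℝ × ℝ)) := by simp
  have hev : ∀ᶠ t in 𝓝 (0 : ℝ), ContDiffWithinAt ℝ k (stretchFlow f) (univ ×ˢ Ici 0) (t, 0) := by
    have h1 := h0.eventually hk
    rw [insert_eq_of_mem (hmem 0)] at h1
    refine Tendsto.eventually (f := fun t : ℝ => ((t, 0) : ℝ × ℝ)) ?_ h1
    exact tendsto_nhdsWithin_iff.2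
      ⟨(by fun_prop : Continuous fun t : ℝ => ((t, 0) : ℝ × ℝ)).tendsto 0, .of_forall hmem⟩
  obtain ⟨N, hN, hN0⟩ : ∃ N : ℕ,
      ContDiffWithinAt ℝ k (stretchFlow f) (univ ×ˢ Ici 0) (t / N, 0) ∧ N ≠ 0 :=
    (((tendsto_const_div_atTop_nhds_zero_nat t).eventually hev).and (eventually_ne_atTop 0)).exists
  have hiter (m : ℕ) : ContDiffWithinAt ℝ k (fun p : ℝ × ℝ => stretchFlow f (m * p.1, p.2))
      (univ ×ˢ Ici 0) (t / N, 0) := by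
    have hdom (m : ℕ) : ∀ᶠ p : ℝ × ℝ in 𝓝[univ ×ˢ Ici 0] (t / N, 0),
        p.2 ∈ Icc (0 : ℝ) 1 ∧ Real.exp (m * p.1) * f p.2 ∈ Icc (0 : ℝ) 1 := by
      have hfst : ∀ᶠ p : ℝ × ℝ in 𝓝[univ ×ˢ Ici 0] (t / N, 0), p.1 < t / N + 1 :=
        (continuous_fst.tendsto ((t / N, 0) : ℝ × ℝ)).eventually
          (gt_mem_nhds (lt_add_one (t / N))) |>.filter_mono nhdsWithin_le_nhds
      have hsnd : Tendsto Prod.snd (𝓝[univ ×ˢ Ici 0] ((t / N, 0) : ℝ × ℝ)) (𝓝[≥] (0 : ℝ)) := by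
        rw [nhdsWithin_prod_eq]
        exact tendsto_snd
      filter_upwards [hfst, hsnd.eventually (hf.eventually_exp_mul_lt (m * (t / N + 1))
        (right_mem_Ioc.2 zero_lt_one))] with p hp1 hp2
      have hfp := (hf.bijOn.mapsTo hp2.1).1
      refine ⟨hp2.1, by positivity, ?_⟩
      refine le_trans ?_ (hp2.2.le.trans (hf.bijOn.mapsTo ⟨zero_le_one, le_rfl⟩).2)
      gcongr
    induction m with
    | zero =>
      refine contDiffWithinAt_snd.congr_of_eventuallyEq_of_mem ?_ (hmem _)
      filter_upwards [hdom 0] with p hp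
      simp [stretchFlow, hf.inv_apply hp.1]
    | succ m ih =>
      have hcomp := ContDiffWithinAt.comp_of_preimage_mem_nhdsWithin_of_eq (g := stretchFlow f)
        (f := fun p : ℝ × ℝ => (p.1, stretchFlow f (m * p.1, p.2))) (t / N, 0) hN
        (contDiffWithinAt_fst.prodMk ih) (by
          filter_upwards [hdom m] with p hp
          exact ⟨trivial, (hf.inv_mem hp.2).1⟩) (by simp [hf.flow_zero_right])
      refine hcomp.congr_of_eventuallyEq_of_mem ?_ (hmem _)
      filter_upwards [hdom m] with p hp
      simp only [stretchFlow, Function.comp_apply, hf.apply_inv hp.2, ← mul_assoc, ← Real.exp_add]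
      push_cast
      ring_nf
  have hscale : ContDiffWithinAt ℝ k (fun p : ℝ × ℝ => (p.1 / N, p.2)) (univ ×ˢ Ici 0) (t, 0) :=
    (contDiff_fst.div_const (N : ℝ) |>.prodMk contDiff_snd).contDiffWithinAt
  have := (hiter N).comp (t, 0) hscale (fun p hp => by simpa using hp)
  refine this.congr_of_eventuallyEq_of_mem (.of_forall fun p => ?_) (hmem t)
  simp [mul_div_cancel₀, hN0]

/-- The flow of `f / f'` is as smooth as `f / f'` up to the boundary. -/
theorem contDiffWithinAt_flow (hf : IsStretchingFunction r f) (hr : r = ∞ ∨ r = ω) (t : ℝ) :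
    ContDiffWithinAt ℝ r (stretchFlow f) (univ ×ˢ Ici 0) (t, 0) := by
  have hr1 := one_le_of_infty_or_omega hr
  have h0 : (0 : ℝ) ∈ Icc (0 : ℝ) 1 := ⟨le_rfl, zero_le_one⟩
  obtain ⟨h, hc, hh⟩ := hf.exists_extension
  rcases hr with rfl | rfl
  · rw [contDiffWithinAt_infty]
    intro k
    -- Order `k + 1` rather than `k`, since the implicit function theorem needs a nonzero order.
    obtain ⟨H, hH, hHh⟩ := exists_contDiff_eqOn_Icc (k + 1) (hc.of_le (by exact_mod_cast le_top))
    have key := hf.contDiffWithinAt_flow_zero hr1 hc hh (k := (k + 1 : ℕ)) (by simp)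
      hH.contDiffAt (hHh.eventuallyEq_of_mem self_mem_nhdsWithin)
    exact (hf.contDiffWithinAt_flow_of_zero (by simp) key t).of_le (by exact_mod_cast Nat.le_succ k)
  · obtain ⟨H, hHh, hH⟩ := analyticWithinAt_iff_exists_analyticAt.1 (hc 0 h0).analyticWithinAt
    rw [insert_eq_of_mem h0] at hHh
    exact hf.contDiffWithinAt_flow_of_zero (by simp)
      (hf.contDiffWithinAt_flow_zero hr1 hc hh (by simp) hH.contDiffAt hHh.symm) t

end IsStretchingFunction

/-! ### Charts of a manifold with boundary -/

section Charts

variable {n : ℕ} [NeZero n] {M : Type*} [TopologicalSpace M] [ChartedSpace (EuclideanHalfSpace n) M]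
  {r : WithTop ℕ∞} {φ ψ : OpenPartialHomeomorph M (EuclideanHalfSpace n)}

/-- The chart expressions of `σ` and `τ` compose to the identity near the point, and derivatives
within the half-space are unique. -/
theorem surjective_fderivWithin_extend [IsManifold (𝓡∂ n) r M] (hr : r ≠ 0)
    (hφ : φ ∈ IsManifold.maximalAtlas (𝓡∂ n) r M) (hψ : ψ ∈ IsManifold.maximalAtlas (𝓡∂ n) r M)
    {σ τ : M → M} (hσ : ContMDiff (𝓡∂ n) (𝓡∂ n) r σ) (hτ : ContMDiff (𝓡∂ n) (𝓡∂ n) r τ)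
    (hτσ : Function.LeftInverse τ σ) (hστ : Function.RightInverse τ σ) {x : M}
    (hx : x ∈ φ.source) (hσx : σ x ∈ ψ.source) :
    Function.Surjective (fderivWithin ℝ (ψ.extend (𝓡∂ n) ∘ σ ∘ (φ.extend (𝓡∂ n)).symm)
      (range (𝓡∂ n)) (φ.extend (𝓡∂ n) x)) := by
  set J := 𝓡∂ n
  set A := ψ.extend J ∘ σ ∘ (φ.extend J).symm
  set B := φ.extend J ∘ τ ∘ (ψ.extend J).symm
  have hA : ContDiffWithinAt ℝ r A (range J) (φ.extend J x) :=
    ((contMDiffAt_iff_of_mem_maximalAtlas hφ hψ hx hσx).1 (hσ x)).2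
  have hB : ContDiffWithinAt ℝ r B (range J) (ψ.extend J (σ x)) :=
    ((contMDiffAt_iff_of_mem_maximalAtlas hψ hφ hσx (by rwa [hτσ x])).1 (hτ (σ x))).2
  have hxs : x ∈ (φ.extend J).source := by rwa [φ.extend_source]
  have hσxs : σ x ∈ (ψ.extend J).source := by rwa [ψ.extend_source]
  have hBx : B (ψ.extend J (σ x)) = φ.extend J x := by
    simp only [B, Function.comp_apply, (ψ.extend J).left_inv hσxs, hτσ x]
  have hmaps : MapsTo B (range J) (range J) := fun v _ => by
    simp [B]
  have hAB : A ∘ B =ᶠ[𝓝[range J] (ψ.extend J (σ x))] id := by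
    have hcont : ContinuousAt (fun v => τ ((ψ.extend J).symm v)) (ψ.extend J (σ x)) :=
      hτ.continuous.continuousAt.comp (ψ.continuousAt_extend_symm hσx)
    have hev : ∀ᶠ v in 𝓝 (ψ.extend J (σ x)), τ ((ψ.extend J).symm v) ∈ φ.source := by
      refine hcont.eventually_mem ?_
      rw [(ψ.extend J).left_inv hσxs, hτσ x]
      exact φ.open_source.mem_nhds hx
    filter_upwards [hev.filter_mono nhdsWithin_le_nhds,
      ψ.extend_target_mem_nhdsWithin (I := J) hσx] with v hv hvt
    simp only [A, B, Function.comp_apply, id]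
    rw [(φ.extend J).left_inv (by rwa [φ.extend_source]), hστ, (ψ.extend J).right_inv hvt]
  have hv : ψ.extend J (σ x) ∈ range J := by simp
  have hA' := (hA.differentiableWithinAt hr).hasFDerivWithinAt
  have hB' := (hB.differentiableWithinAt hr).hasFDerivWithinAt
  rw [← hBx] at hA' ⊢
  have h1 := hA'.comp _ hB' hmaps
  have h2 : HasFDerivWithinAt (A ∘ B) (ContinuousLinearMap.id ℝ _) (range J)
      (ψ.extend J (σ x)) :=
    (hasFDerivWithinAt_id _ _).congr_of_eventuallyEq hAB (hAB.eq_of_nhdsWithin hv)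
  have h3 := (J.uniqueDiffOn _ hv).eq h1 h2
  exact fun e => ⟨_, DFunLike.congr_fun h3 e⟩

/-- A map into a closed convex set with surjective derivative at an interior point of its domain
cannot reach the boundary of that set there. With `σ = id` this gives the independence of the
interior from the chart. -/
theorem extend_mem_interior_range [IsManifold (𝓡∂ n) r M] (hr : r ≠ 0)
    (hφ : φ ∈ IsManifold.maximalAtlas (𝓡∂ n) r M) (hψ : ψ ∈ IsManifold.maximalAtlas (𝓡∂ n) r M)
    {σ τ : M → M} (hσ : ContMDiff (𝓡∂ n) (𝓡∂ n) r σ) (hτ : ContMDiff (𝓡∂ n) (𝓡∂ n) r τ)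
    (hτσ : Function.LeftInverse τ σ) (hστ : Function.RightInverse τ σ) {x : M}
    (hx : x ∈ φ.source) (hσx : σ x ∈ ψ.source)
    (hint : φ.extend (𝓡∂ n) x ∈ interior (range (𝓡∂ n))) :
    ψ.extend (𝓡∂ n) (σ x) ∈ interior (range (𝓡∂ n)) := by
  set J := 𝓡∂ n
  have hnhds := mem_interior_iff_mem_nhds.1 hint
  have hsurj := surjective_fderivWithin_extend hr hφ hψ hσ hτ hτσ hστ hx hσx
  rw [fderivWithin_of_mem_nhds hnhds] at hsurj
  have hA := ((contMDiffAt_iff_of_mem_maximalAtlas hφ hψ hx hσx).1 (hσ x)).2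
  have := ((hA.contDiffAt hnhds).differentiableAt hr).mem_interior_convex_of_surjective_fderiv
    univ_mem J.convex_range J.isClosed_range J.nonempty_interior
    (fun v _ => by simp) hsurj
  simpa [φ.left_inv hx] using this

theorem apply_mem_interior [IsManifold (𝓡∂ n) r M] (hr : r ≠ 0)
    {σ τ : M → M} (hσ : ContMDiff (𝓡∂ n) (𝓡∂ n) r σ) (hτ : ContMDiff (𝓡∂ n) (𝓡∂ n) r τ)
    (hτσ : Function.LeftInverse τ σ) (hστ : Function.RightInverse τ σ) {x : M}
    (hx : x ∈ (𝓡∂ n).interior M) : σ x ∈ (𝓡∂ n).interior M :=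
  extend_mem_interior_range hr (IsManifold.chart_mem_maximalAtlas x)
    (IsManifold.chart_mem_maximalAtlas (σ x)) hσ hτ hτσ hστ (mem_chart_source _ x)
    (mem_chart_source _ (σ x)) hx

theorem chart_apply_zero_eq_zero_of_boundary [IsManifold (𝓡∂ n) r M] (hr : r ≠ 0)
    (hφ : φ ∈ IsManifold.maximalAtlas (𝓡∂ n) r M) {x : M} (hx : x ∈ φ.source)
    (hxb : x ∈ (𝓡∂ n).boundary M) : (φ x).1 0 = 0 := by
  by_contra h
  have hpos : 0 < (φ x).1 0 := lt_of_le_of_ne (φ x).2 (Ne.symm h)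
  have hint : φ.extend (𝓡∂ n) x ∈ interior (range (𝓡∂ n)) := by
    rw [interior_range_modelWithCornersEuclideanHalfSpace]
    exact hpos
  have : x ∈ (𝓡∂ n).interior M := extend_mem_interior_range hr hφ
    (IsManifold.chart_mem_maximalAtlas x) contMDiff_id contMDiff_id (fun _ => rfl) (fun _ => rfl) hx
    (mem_chart_source _ x) hint
  rw [← ModelWithCorners.compl_interior] at hxb
  exact hxb this

theorem chart_apply_zero_eq_zero_of_inverse [IsManifold (𝓡∂ n) r M] (hr : r ≠ 0)
    (hφ : φ ∈ IsManifold.maximalAtlas (𝓡∂ n) r M) (hψ : ψ ∈ IsManifold.maximalAtlas (𝓡∂ n) r M)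
    {σ τ : M → M} (hσ : ContMDiff (𝓡∂ n) (𝓡∂ n) r σ) (hτ : ContMDiff (𝓡∂ n) (𝓡∂ n) r τ)
    (hτσ : Function.LeftInverse τ σ) (hστ : Function.RightInverse τ σ) {x : M}
    (hx : x ∈ φ.source) (hσx : σ x ∈ ψ.source) (h0 : (φ x).1 0 = 0) : (ψ (σ x)).1 0 = 0 := by
  by_contra h
  have hpos : 0 < (ψ (σ x)).1 0 := lt_of_le_of_ne (ψ (σ x)).2 (Ne.symm h)
  have hint : ψ.extend (𝓡∂ n) (σ x) ∈ interior (range (𝓡∂ n)) := by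
    rw [interior_range_modelWithCornersEuclideanHalfSpace]
    exact hpos
  have := extend_mem_interior_range hr hψ hφ hτ hσ hστ hτσ hσx (by rwa [hτσ x]) hint
  rw [hτσ x, interior_range_modelWithCornersEuclideanHalfSpace] at this
  exact (show 0 < (φ x).1 0 from this).ne' h0

end Charts

/-! ### The boundary factor of a smooth action -/

section Action

variable {n : ℕ} [NeZero n] {M : Type*} [TopologicalSpace M] [ChartedSpace (EuclideanHalfSpace n) M]
  {E : Type*} [NormedAddCommGroup E] [NormedSpace ℝ E]
  {G : Type*} [TopologicalSpace G] [ChartedSpace E G] [Group G]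
  {r : WithTop ℕ∞} {ρ₀ : G → M → M}

namespace IsDiffAction

theorem contMDiff_apply (h : IsDiffAction (n := n) (E := E) r ρ₀) (g : G) :
    ContMDiff (𝓡∂ n) (𝓡∂ n) r (ρ₀ g) :=
  h.contMDiff.comp (contMDiff_const.prodMk contMDiff_id)

theorem inv_apply_apply (h : IsDiffAction (n := n) (E := E) r ρ₀) (g : G) (x : M) :
    ρ₀ g⁻¹ (ρ₀ g x) = x := by
  rw [← h.mul_act, inv_mul_cancel, h.one_act]

theorem apply_inv_apply (h : IsDiffAction (n := n) (E := E) r ρ₀) (g : G) (x : M) :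
    ρ₀ g (ρ₀ g⁻¹ x) = x := by
  rw [← h.mul_act, mul_inv_cancel, h.one_act]

theorem mem_interior [IsManifold (𝓡∂ n) r M] (hr : r ≠ 0)
    (h : IsDiffAction (n := n) (E := E) r ρ₀) (g : G) {x : M} (hx : x ∈ (𝓡∂ n).interior M) :
    ρ₀ g x ∈ (𝓡∂ n).interior M :=
  apply_mem_interior hr (h.contMDiff_apply g) (h.contMDiff_apply g⁻¹) (h.inv_apply_apply g)
    (h.apply_inv_apply g) hx

theorem mem_boundary [IsManifold (𝓡∂ n) r M] (hr : r ≠ 0)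
    (h : IsDiffAction (n := n) (E := E) r ρ₀) (g : G) {x : M} (hx : x ∈ (𝓡∂ n).boundary M) :
    ρ₀ g x ∈ (𝓡∂ n).boundary M := by
  rw [← ModelWithCorners.compl_interior] at hx ⊢
  intro hint
  have := h.mem_interior hr g⁻¹ hint
  rw [h.inv_apply_apply] at this
  exact hx this

/-- In charts, the boundary coordinate of `ρ₀ g z` is the boundary coordinate of `z` times a
positive `C^r` function of `(g, z)`. -/
theorem exists_factor [IsManifold 𝓘(ℝ, E) r G] [IsManifold (𝓡∂ n) r M] (hr : r = ∞ ∨ r = ω)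
    (h : IsDiffAction (n := n) (E := E) r ρ₀) (g₀ : G) {z₀ : M} (hz₀ : z₀ ∈ (𝓡∂ n).boundary M)
    {φ ψ : OpenPartialHomeomorph M (EuclideanHalfSpace n)}
    (hφ : φ ∈ IsManifold.maximalAtlas (𝓡∂ n) r M) (hψ : ψ ∈ IsManifold.maximalAtlas (𝓡∂ n) r M)
    (hz₀φ : z₀ ∈ φ.source) (hz₀ψ : ρ₀ g₀ z₀ ∈ ψ.source) :
    ∃ u : G × M → ℝ, ContMDiffAt (𝓘(ℝ, E).prod (𝓡∂ n)) 𝓘(ℝ, ℝ) r u (g₀, z₀) ∧ 0 < u (g₀, z₀) ∧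
      ∀ᶠ p : G × M in 𝓝 (g₀, z₀), (ψ (ρ₀ p.1 p.2)).1 0 = (φ p.2).1 0 * u p := by
  have hr0 : r ≠ 0 := by rcases hr with rfl | rfl <;> simp
  set J := 𝓡∂ n
  set Φ := ((chartAt E g₀).prod φ).extend (𝓘(ℝ, E).prod J)
  have hχ : (chartAt E g₀).prod φ ∈ IsManifold.maximalAtlas (𝓘(ℝ, E).prod J) r (G × M) :=
    IsManifold.mem_maximalAtlas_prod (IsManifold.chart_mem_maximalAtlas g₀) hφ
  have hsrc : (g₀, z₀) ∈ ((chartAt E g₀).prod φ).source := ⟨mem_chart_source _ g₀, hz₀φ⟩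
  let e₀ : EuclideanSpace ℝ (Fin n) := EuclideanSpace.single 0 1
  let π : EuclideanSpace ℝ (Fin n) →L[ℝ] ℝ := EuclideanSpace.proj 0
  let ℓ : E × EuclideanSpace ℝ (Fin n) →L[ℝ] ℝ := π.comp (ContinuousLinearMap.snd ℝ E _)
  have hJ : range J = {v | 0 ≤ v 0} := range_modelWithCornersEuclideanHalfSpace n
  have hrange : range (𝓘(ℝ, E).prod J) = {v | 0 ≤ ℓ v} := by
    rw [ModelWithCorners.range_prod, hJ]
    ext v
    simp [ℓ, π]
  have hφ0 : (φ z₀).1 0 = 0 := chart_apply_zero_eq_zero_of_boundary hr0 hφ hz₀φ hz₀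
  have hΦsrc : (g₀, z₀) ∈ Φ.source := by rwa [OpenPartialHomeomorph.extend_source]
  have hev : ∀ᶠ p : G × M in 𝓝 (g₀, z₀), p.2 ∈ φ.source ∧ ρ₀ p.1 p.2 ∈ ψ.source :=
    (continuous_snd.continuousAt.eventually_mem (φ.open_source.mem_nhds hz₀φ)).and
      (h.contMDiff.continuous.continuousAt.eventually_mem (ψ.open_source.mem_nhds hz₀ψ))
  let Y : E × EuclideanSpace ℝ (Fin n) → ℝ := fun v =>
    π (ψ.extend J (ρ₀ (Φ.symm v).1 (Φ.symm v).2))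
  have hY : ContDiffWithinAt ℝ r Y {v | 0 ≤ ℓ v} (Φ (g₀, z₀)) := by
    have := ((contMDiffAt_iff_of_mem_maximalAtlas hχ hψ hsrc hz₀ψ).1 (h.contMDiff (g₀, z₀))).2
    rw [hrange] at this
    exact π.contDiff.comp_contDiffWithinAt this
  -- The boundary is preserved by every `ρ₀ g`, as Hadamard's lemma requires.
  have hY0 : ∀ᶠ v in 𝓝[{v | 0 ≤ ℓ v}] (Φ (g₀, z₀)), ℓ v = 0 → Y v = 0 := by
    have hcont : ContinuousAt Φ.symm (Φ (g₀, z₀)) :=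
      OpenPartialHomeomorph.continuousAt_extend_symm _ hsrc
    have h1 : ∀ᶠ v in 𝓝 (Φ (g₀, z₀)),
        (Φ.symm v).2 ∈ φ.source ∧ ρ₀ (Φ.symm v).1 (Φ.symm v).2 ∈ ψ.source := by
      have := hcont.tendsto
      rw [Φ.left_inv hΦsrc] at this
      exact this.eventually hev
    have h2 := OpenPartialHomeomorph.extend_target_mem_nhdsWithin
      (I := 𝓘(ℝ, E).prod J) ((chartAt E g₀).prod φ) hsrc
    rw [hrange] at h2
    filter_upwards [h1.filter_mono nhdsWithin_le_nhds, h2] with v hv hvt hℓ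
    refine chart_apply_zero_eq_zero_of_inverse hr0 hφ hψ (h.contMDiff_apply _)
      (h.contMDiff_apply _) (h.inv_apply_apply (Φ.symm v).1) (h.apply_inv_apply _) hv.1 hv.2 ?_
    have : Φ (Φ.symm v) = v := Φ.right_inv hvt
    rw [← this] at hℓ
    exact hℓ
  obtain ⟨u, hu, hYu⟩ := exists_contDiffWithinAt_eq_mul ℓ (e := (0, e₀)) (by simp [ℓ, π, e₀])
    (v₀ := Φ (g₀, z₀)) hφ0 hr hY hY0
  have hfac : ∀ᶠ p : G × M in 𝓝 (g₀, z₀), (ψ (ρ₀ p.1 p.2)).1 0 = (φ p.2).1 0 * u (Φ p) := by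
    have htend : Tendsto Φ (𝓝 (g₀, z₀)) (𝓝[{v | 0 ≤ ℓ v}] (Φ (g₀, z₀))) := by
      rw [← hrange]
      exact (OpenPartialHomeomorph.map_extend_nhds _ hsrc).le
    filter_upwards [htend.eventually hYu, OpenPartialHomeomorph.extend_source_mem_nhds
      (I := 𝓘(ℝ, E).prod J) ((chartAt E g₀).prod φ) hsrc] with p hp hps
    have : Φ.symm (Φ p) = p := Φ.left_inv hps
    simp only [Y, this] at hp
    exact hp
  refine ⟨u ∘ Φ, ?_, ?_, hfac⟩
  · have hΦ := OpenPartialHomeomorph.contMDiffAt_extend hχ hsrc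
    refine ContMDiffWithinAt.comp (t := {v | 0 ≤ ℓ v}) _ hu.contMDiffWithinAt hΦ fun p _ => ?_
    rw [← hrange]
    exact mem_range_self _
  set v₀ := φ.extend J z₀ with hv₀def
  set a := chartAt E g₀ g₀
  have hv₀J : v₀ ∈ range J := mem_range_self _
  -- The factor with `g = g₀` frozen; only its sign at `v₀` remains to be found.
  let c : EuclideanSpace ℝ (Fin n) → ℝ := fun v => u (a, v)
  have hc : ContDiffWithinAt ℝ r c (range J) v₀ :=
    ContDiffWithinAt.comp v₀ (g := u) hu (contDiff_const.prodMk contDiff_id).contDiffWithinAt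
      (fun v hv => by rwa [hJ] at hv)
  have hcv₀ : (u ∘ Φ) (g₀, z₀) = c v₀ := rfl
  rw [hcv₀]
  set A := ψ.extend J ∘ ρ₀ g₀ ∘ (φ.extend J).symm
  have hA : ContDiffWithinAt ℝ r A (range J) v₀ :=
    ((contMDiffAt_iff_of_mem_maximalAtlas hφ hψ hz₀φ hz₀ψ).1 (h.contMDiff_apply g₀ z₀)).2
  have hAc : ∀ᶠ v in 𝓝[range J] v₀, π (A v) = π v * c v := by
    have hcont : Tendsto (fun v => (g₀, (φ.extend J).symm v)) (𝓝 v₀) (𝓝 (g₀, z₀)) := by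
      have := (φ.continuousAt_extend_symm (I := J) hz₀φ).tendsto
      rw [φ.extend_left_inv hz₀φ] at this
      exact tendsto_const_nhds.prodMk_nhds this
    filter_upwards [(hcont.eventually hfac).filter_mono nhdsWithin_le_nhds,
      φ.extend_target_mem_nhdsWithin (I := J) hz₀φ] with v hv hvt
    have hri : φ.extend J ((φ.extend J).symm v) = v := (φ.extend J).right_inv hvt
    have h1 : (φ ((φ.extend J).symm v)).1 0 = π v := by
      conv_rhs => rw [← hri]
      rfl
    have h2 : Φ (g₀, (φ.extend J).symm v) = (a, v) := by
      conv_rhs => rw [← hri]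
      rfl
    simp only [h1, h2] at hv
    exact hv
  have hπv₀ : π v₀ = 0 := hφ0
  -- Nonnegativity: along the inward ray `v₀ + t • e₀` the boundary coordinate of the image is `t *
  -- c ≥ 0`. Nonvanishing: since `π v₀ = 0`, the product rule gives `π ∘ DA = c v₀ • π`, and `c v₀ =
  -- 0` would prevent `DA` from reaching `e₀`.
  refine lt_of_le_of_ne ?_ ?_
  · have htend : Tendsto (fun t : ℝ => v₀ + t • e₀) (𝓝[>] 0) (𝓝[range J] v₀) := by
      refine tendsto_nhdsWithin_iff.2 ⟨?_, ?_⟩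
      · have : Continuous fun t : ℝ => v₀ + t • e₀ := by fun_prop
        have := this.tendsto 0
        rw [zero_smul, add_zero] at this
        exact this.mono_left nhdsWithin_le_nhds
      · filter_upwards [self_mem_nhdsWithin] with t ht
        rw [hJ]
        have : v₀ 0 = 0 := hφ0
        simpa [e₀, this] using le_of_lt ht
    refine ge_of_tendsto (hc.continuousWithinAt.tendsto.comp htend) ?_
    filter_upwards [htend.eventually hAc, self_mem_nhdsWithin] with t ht ht0
    have hnn : 0 ≤ π (A (v₀ + t • e₀)) := (ψ _).2
    have : π (v₀ + t • e₀) = t := by simp [π, e₀, show v₀ 0 = 0 from hφ0]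
    rw [ht, this] at hnn
    exact nonneg_of_mul_nonneg_right hnn ht0
  · intro hc0
    have hA' := (hA.differentiableWithinAt hr0).hasFDerivWithinAt
    have h1 : HasFDerivWithinAt (fun v => π (A v)) (π.comp (fderivWithin ℝ A (range J) v₀))
        (range J) v₀ := π.hasFDerivAt.comp_hasFDerivWithinAt v₀ hA'
    have h2 := (π.hasFDerivWithinAt (s := range J) (x := v₀)).mul
      (hc.differentiableWithinAt hr0).hasFDerivWithinAt
    have h3 := (J.uniqueDiffOn _ hv₀J).eq h1
      (h2.congr_of_eventuallyEq hAc (hAc.self_of_nhdsWithin hv₀J))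
    obtain ⟨b, hb⟩ := surjective_fderivWithin_extend hr0 hφ hψ (h.contMDiff_apply g₀)
      (h.contMDiff_apply g₀⁻¹) (h.inv_apply_apply g₀) (h.apply_inv_apply g₀) hz₀φ hz₀ψ e₀
    have h4 := DFunLike.congr_fun h3 b
    rw [ContinuousLinearMap.comp_apply, hb] at h4
    rw [hπv₀, ← hc0] at h4
    simp [π, e₀] at h4

end IsDiffAction

end Action

/-! ### Regularity of the pulled back action -/

section Pullback

variable {n : ℕ} [NeZero n] {M : Type*} [TopologicalSpace M] [ChartedSpace (EuclideanHalfSpace n) M]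
  {E : Type*} [NormedAddCommGroup E] [NormedSpace ℝ E]
  {G : Type*} [TopologicalSpace G] [ChartedSpace E G] [Group G]
  {r : WithTop ℕ∞} {ρ₀ : G → M → M} {f : ℝ → ℝ} {Φ : M ≃ₜ M}

namespace IsStretchingMap

theorem mem_interior (h : IsStretchingMap (n := n) r f Φ) {x : M}
    (hx : x ∈ (𝓡∂ n).interior M) : Φ x ∈ (𝓡∂ n).interior M := h.bijOn_interior.mapsTo hx

theorem symm_mem_interior (h : IsStretchingMap (n := n) r f Φ) {x : M}
    (hx : x ∈ (𝓡∂ n).interior M) : Φ.symm x ∈ (𝓡∂ n).interior M := by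
  obtain ⟨y, hy, rfl⟩ := h.bijOn_interior.surjOn hx
  rwa [Φ.symm_apply_apply]

theorem mem_boundary (h : IsStretchingMap (n := n) r f Φ) {x : M}
    (hx : x ∈ (𝓡∂ n).boundary M) : Φ x ∈ (𝓡∂ n).boundary M := by
  rw [← ModelWithCorners.compl_interior] at hx ⊢
  intro hint
  have := h.symm_mem_interior hint
  rw [Φ.symm_apply_apply] at this
  exact hx this

theorem symm_mem_boundary (h : IsStretchingMap (n := n) r f Φ) {x : M}
    (hx : x ∈ (𝓡∂ n).boundary M) : Φ.symm x ∈ (𝓡∂ n).boundary M := by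
  rw [← ModelWithCorners.compl_interior] at hx ⊢
  intro hint
  have := h.mem_interior hint
  rw [Φ.apply_symm_apply] at this
  exact hx this

end IsStretchingMap

theorem contMDiffAt_pullbackAction_of_interior [IsManifold (𝓡∂ n) r M] (hr : r ≠ 0)
    (hρ₀ : IsDiffAction (n := n) (E := E) r ρ₀) (hΦ : IsStretchingMap (n := n) r f Φ) (g₀ : G)
    {p : M} (hp : p ∈ (𝓡∂ n).interior M) :
    ContMDiffAt (𝓘(ℝ, E).prod (𝓡∂ n)) (𝓡∂ n) r
      (fun q : G × M => pullbackAction Φ ρ₀ q.1 q.2) (g₀, p) := by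
  have h1 : ContMDiff (𝓘(ℝ, E).prod (𝓡∂ n)) (𝓡∂ n) r (fun q : G × M => ρ₀ q.1 (Φ q.2)) :=
    hρ₀.contMDiff.comp (contMDiff_fst.prodMk (hΦ.contMDiff.comp contMDiff_snd))
  have h2 : ContMDiffAt (𝓡∂ n) (𝓡∂ n) r Φ.symm (ρ₀ g₀ (Φ p)) :=
    hΦ.contMDiffOn_symm.contMDiffAt (((𝓡∂ n).isOpen_interior (n := r) hr).mem_nhds
      (hρ₀.mem_interior hr g₀ (hΦ.mem_interior hp)))
  exact h2.comp (g₀, p) (h1 (g₀, p))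

/-- Stretching charts are taken at `p` and at `P (g₀, p)`. The relation `Φ (P (g, x)) = ρ₀ g (Φ x)`
reads `f y' = u * f y` in the boundary coordinates, so that `y'` is the flow of `y` at time `log u`.
It also equates the remaining coordinates of `P (g, x)` with those of `ρ₀ g (Φ x)`. -/
theorem contMDiffAt_pullbackAction_of_boundary [IsManifold 𝓘(ℝ, E) r G] [IsManifold (𝓡∂ n) r M]
    (hr : r = ∞ ∨ r = ω) (hf : IsStretchingFunction r f)
    (hρ₀ : IsDiffAction (n := n) (E := E) r ρ₀) (hΦ : IsStretchingMap (n := n) r f Φ) (g₀ : G)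
    {p : M} (hp : p ∈ (𝓡∂ n).boundary M) :
    ContMDiffAt (𝓘(ℝ, E).prod (𝓡∂ n)) (𝓡∂ n) r
      (fun q : G × M => pullbackAction Φ ρ₀ q.1 q.2) (g₀, p) := by
  have hr0 : r ≠ 0 := by rcases hr with rfl | rfl <;> simp
  set J := 𝓡∂ n
  set P : G × M → M := fun q => pullbackAction Φ ρ₀ q.1 q.2
  have hΦP (q : G × M) : Φ (P q) = ρ₀ q.1 (Φ q.2) := Φ.apply_symm_apply _
  have hPb : P (g₀, p) ∈ J.boundary M :=
    hΦ.symm_mem_boundary (hρ₀.mem_boundary hr0 g₀ (hΦ.mem_boundary hp))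
  obtain ⟨φ, hφ, ψ, hψ, hpφ, hpψ, hloc⟩ := hΦ.exists_charts p hp
  obtain ⟨φ', hφ', ψ', hψ', hpφ', hpψ', hloc'⟩ := hΦ.exists_charts _ hPb
  rw [hΦP] at hpψ'
  obtain ⟨u, hu, hupos, hfac⟩ := hρ₀.exists_factor hr g₀ (hΦ.mem_boundary hp) hψ hψ' hpψ hpψ'
  have hR : ContMDiff (𝓘(ℝ, E).prod J) J r (fun q : G × M => ρ₀ q.1 (Φ q.2)) :=
    hρ₀.contMDiff.comp (contMDiff_fst.prodMk (hΦ.contMDiff.comp contMDiff_snd))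
  have hPc : Continuous P := Φ.symm.continuous.comp hR.continuous
  let e₀ : EuclideanSpace ℝ (Fin n) := EuclideanSpace.single 0 1
  let π : EuclideanSpace ℝ (Fin n) →L[ℝ] ℝ := EuclideanSpace.proj 0
  have hpair : ContMDiff (𝓘(ℝ, E).prod J) (𝓘(ℝ, E).prod J) r (fun q : G × M => (q.1, Φ q.2)) :=
    contMDiff_fst.prodMk (hΦ.contMDiff.comp contMDiff_snd)
  let U : G × M → ℝ := fun q => u (q.1, Φ q.2)
  have hU : ContMDiffAt (𝓘(ℝ, E).prod J) 𝓘(ℝ, ℝ) r U (g₀, p) :=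
    ContMDiffAt.comp (g := u) (g₀, p) hu (hpair (g₀, p))
  have hlog : ContMDiffAt (𝓘(ℝ, E).prod J) 𝓘(ℝ, ℝ) r (fun q => Real.log (U q)) (g₀, p) :=
    (Real.contDiffAt_log.2 hupos.ne').contMDiffAt.comp (g₀, p) hU
  have hy : ContMDiffAt (𝓘(ℝ, E).prod J) 𝓘(ℝ, ℝ) r
      (fun q : G × M => π (φ.extend J q.2)) (g₀, p) :=
    π.contDiff.contMDiff.contMDiffAt.comp (g₀, p)
      (ContMDiffAt.comp (g₀, p) (φ.contMDiffAt_extend hφ hpφ) contMDiffAt_snd)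
  have hφp : π (φ.extend J p) = 0 := chart_apply_zero_eq_zero_of_boundary hr0 hφ hpφ hp
  let Y : G × M → ℝ := fun q => stretchFlow f (Real.log (U q), π (φ.extend J q.2))
  have hY : ContMDiffAt (𝓘(ℝ, E).prod J) 𝓘(ℝ, ℝ) r Y (g₀, p) := by
    refine ContMDiffWithinAt.comp (t := univ ×ˢ Ici 0) (I' := 𝓘(ℝ, ℝ × ℝ)) (g := stretchFlow f)
      (f := fun q : G × M => (Real.log (U q), π (φ.extend J q.2))) (g₀, p) ?_
      (hlog.prodMk_space hy) fun q _ => ⟨trivial, (φ q.2).2⟩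
    simp only [hφp]
    exact (hf.contDiffWithinAt_flow hr _).contMDiffWithinAt
  let R : G × M → EuclideanSpace ℝ (Fin n) := fun q => ψ'.extend J (ρ₀ q.1 (Φ q.2))
  have hRe : ContMDiffAt (𝓘(ℝ, E).prod J) 𝓘(ℝ, EuclideanSpace ℝ (Fin n)) r R (g₀, p) :=
    ContMDiffAt.comp (g₀, p) (ψ'.contMDiffAt_extend hψ' hpψ') (hR (g₀, p))
  have hRπ : ContMDiffAt (𝓘(ℝ, E).prod J) 𝓘(ℝ, ℝ) r (fun q => π (R q)) (g₀, p) :=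
    π.contDiff.contMDiff.contMDiffAt.comp (g₀, p) hRe
  -- The vector `R q` with its coordinate of index `0` replaced by `Y q`: the chart expression of
  -- `P`.
  have hfinal : ContMDiffAt (𝓘(ℝ, E).prod J) 𝓘(ℝ, EuclideanSpace ℝ (Fin n)) r
      (fun q => R q + (Y q - π (R q)) • e₀) (g₀, p) :=
    hRe.add ((hY.sub hRπ).smul contMDiffAt_const)
  rw [← contMDiffWithinAt_univ, contMDiffWithinAt_iff_target_of_mem_maximalAtlas hφ' hpφ']
  refine ⟨hPc.continuousWithinAt, contMDiffWithinAt_univ.2 (hfinal.congr_of_eventuallyEq ?_)⟩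
  have hφ'P : ContinuousAt (fun q => π (φ'.extend J (P q))) (g₀, p) :=
    π.continuous.continuousAt.comp ((φ'.continuousAt_extend hpφ').comp hPc.continuousAt)
  have hφ'P0 : π (φ'.extend J (P (g₀, p))) = 0 :=
    chart_apply_zero_eq_zero_of_boundary hr0 hφ' hpφ' hPb
  -- Since `f` is controlled only on `[0,1]`, the boundary coordinate of `P q` must stay there to be
  -- recovered from its image under `f`.
  have hlt : ∀ᶠ q in 𝓝 (g₀, p), π (φ'.extend J (P q)) < 1 :=
    hφ'P.eventually_lt continuousAt_const (by rw [hφ'P0]; exact zero_lt_one)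
  have hUpos : ∀ᶠ q in 𝓝 (g₀, p), 0 < U q :=
    continuousAt_const.eventually_lt hU.continuousAt hupos
  filter_upwards [continuousAt_snd.eventually hloc, hPc.continuousAt.eventually hloc',
    hpair.continuous.continuousAt.eventually hfac, hlt, hUpos] with q h1 h2 h3 h4 h5
  simp only [hΦP] at h2 h3
  have hYq : Y q = π (φ'.extend J (P q)) := by
    have hmem : π (φ'.extend J (P q)) ∈ Icc (0 : ℝ) 1 := ⟨(φ' (P q)).2, h4.le⟩
    have : Real.exp (Real.log (U q)) * f (π (φ.extend J q.2)) = f (π (φ'.extend J (P q))) := by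
      rw [Real.exp_log h5, mul_comm]
      calc f (π (φ.extend J q.2)) * U q = (ψ (Φ q.2)).1 0 * u (q.1, Φ q.2) := by rw [h1.1]; rfl
        _ = f (π (φ'.extend J (P q))) := by rw [← h3, h2.1]; rfl
    simp only [Y, stretchFlow, this, hf.inv_apply hmem]
  ext i
  by_cases hi : i = 0
  · subst hi
    simp only [hYq, Function.comp_apply]
    simp [π, e₀]
    rfl
  · have := h2.2 i hi
    simp only [Function.comp_apply, PiLp.add_apply, PiLp.smul_apply]
    simp only [e₀, PiLp.single_apply, hi, if_false, smul_zero, add_zero]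
    exact this.symm

end Pullback

theorem mainTheorem4 (r : WithTop ℕ∞) (hr : r = ∞ ∨ r = ω)
    {E : Type*} [NormedAddCommGroup E] [NormedSpace ℝ E] [FiniteDimensional ℝ E]
    {G : Type*} [TopologicalSpace G] [T2Space G] [SecondCountableTopology G]
    [ChartedSpace E G] [Group G] [LieGroup 𝓘(ℝ, E) r G] [ConnectedSpace G]
    {n : ℕ} [NeZero n]
    {M : Type*} [TopologicalSpace M] [T2Space M] [SecondCountableTopology M]
    [ChartedSpace (EuclideanHalfSpace n) M] [IsManifold (𝓡∂ n) r M]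
    (ρ₀ : G → M → M) (hρ₀ : IsDiffAction (n := n) (E := E) r ρ₀)
    (htrans : ∀ x ∈ (𝓡∂ n).interior M, ∀ y ∈ (𝓡∂ n).interior M, ∃ g : G, ρ₀ g x = y)
    (ρ : G → M → M) (hρ : IsStretch (n := n) r ρ₀ ρ) :
    IsDiffAction (n := n) (E := E) r ρ := by
  have hr0 : r ≠ 0 := by rcases hr with rfl | rfl <;> simp
  obtain ⟨f, Φ, hf, hΦ, rfl⟩ := hρ
  refine ⟨fun x => ?_, fun g h x => ?_, fun ⟨g, p⟩ => ?_⟩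
  · simp [pullbackAction, hρ₀.one_act]
  · simp [pullbackAction, hρ₀.mul_act]
  · rcases (𝓡∂ n).isInteriorPoint_or_isBoundaryPoint p with hp | hp
    · exact contMDiffAt_pullbackAction_of_interior hr0 hρ₀ hΦ g hp
    · exact contMDiffAt_pullbackAction_of_boundary hr hf hρ₀ hΦ g hp
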